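/- **Setting.** A *separation algebra* is a set $\Sigma$ with a partial, commutative, associative and cancellative operation $*$ (equalities meaning that both sides are undefined, or both are defined and equal) and a unit. The *footprint* of $\sigma\in\Sigma$ is $\delta(\sigma)=\{\sigma' \mid \forall\sigma''.\ \sigma'*\sigma''\text{ is defined}\iff\sigma*\sigma''\text{ is defined}\}$. Fix a separation algebra $\Sigma$ that is *cancellative on footprints*: if $\sigma_1*\sigma_2$ and $\sigma_1'*\sigma_2'$ are defined, $\delta(\sigma_1*\sigma_2)=\delta(\sigma_1'*\sigma_2')$ and $\delta(\sigma_1)=\delta(\sigma_1')$, then $\delta(\sigma_2)=\delta(\sigma_2')$. For footprints write $l_1\preceq l_2$ if there are $\sigma_1,\sigma$ with $\sigma_1*\sigma$ defined, $l_1=\delta(\sigma_1)$ and $l_2=\delta(\sigma_1*\sigma)$. For $p,q\subseteq\Sigma$ let $p*q=\{\sigma_1*\sigma_2\mid\sigma_1\in p,\ \sigma_2\in q,\ \sigma_1*\sigma_2\text{ defined}\}$. Thread identifiers are natural numbers. Every primitive command $c$ and thread $t$ have a transformer $f^t_c:\Sigma\to 2^\Sigma\cup\{\top\}$ ($\top$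 is a fault) with - *Footprint Preservation*: $\sigma'\in f^t_c(\sigma)$ implies $\delta(\sigma')=\delta(\sigma)$; - *Strong Locality*: if $\sigma_1*\sigma_2$ is defined and $f^t_c(\sigma_1)\neq\top$, then $f^t_c(\sigma_1*\sigma_2)=f^t_c(\sigma_1)*\{\sigma_2\}$. **Programs.** Commands are $C::=c\mid m\mid C;C\mid C+C\mid C^*$, where $m$ is a method call. A library $\mathcal L$ maps its methods to bodies, which call no methods. A client $\mathcal C$ is a parallel composition $C_1\parallel\dots\parallel C_n$ of commands, one for each thread. $\mathcal C(\mathcal L)$ is the complete program in which the calls of $\mathcal C$ are implemented by $\mathcal L$. A method specification $\Gamma$ gives to each method in its domain a pair of predicates $p_t,q_t\subseteq\Sigma$ for every thread $t$, all of them *precise*: each state $\sigma$ has at most one $\sigma_1$ in the predicate with $\sigma=\sigma_1*\sigma_2$ for some $\sigma_2$. $\mathcal L:\Gamma$ means that the methods of $\mathcal L$ are those specified by $\Gamma$; $\Gamma\vdash\mathcal C$ means that all the methods called in $\mathcal C$ are specified by $\Gamma$. **Trace sets.** Actions are $(t,c)$, $(t,\mathsf{call}\ m)$ and $(t,\mathsf{ret}\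 m)$. In the trace set of a command run by $t$, a call of $m$ yields $(t,\mathsf{call}\ m)\,\tau\,(t,\mathsf{ret}\ m)$ with $\tau$ a trace of the body of $m$; the other constructs have their usual meaning, and parallel composition interleaves the traces of its threads. The trace set of $\mathcal C(\mathcal L)$ uses the bodies from $\mathcal L$; that of $\Gamma\vdash\mathcal C$ uses the empty trace as the only trace of each body; that of $\mathcal L:\Gamma$ is the union, over $k\ge1$, of the trace sets of $k$ parallel threads, each running $(m_1+\dots+m_j)^*$, where $m_1,\dots,m_j$ are the methods of $\mathcal L$ with bodies from $\mathcal L$. All three are closed under prefixes. **Evaluation.** A trace is evaluated from a state action by action, yielding final states and (possibly annotated) traces, or the fault $\top$ if some action faults in a reached state; $(t,c)$ is evaluated by $f^t_c$. - In $\mathcal C(\mathcal L)$, calls and returns leave the state and the action unchanged. - In $\mathcal L:\Gamma$ (library-local), $(t,\mathsf{call}\ m)$ takes $\sigma$ to $\sigma*\sigma_p$ for any $\sigma_p\in p_t$ with $\sigma*\sigma_p$ defined, and is annotated to $(t,\mathsf{call}\ m(\sigma_p))$; $(t,\mathsf{ret}\ m)$ takes $\sigma=\sigma'*\sigma_q$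 with $\sigma_q\in q_t$ to $\sigma'$, is annotated to $(t,\mathsf{ret}\ m(\sigma_q))$, and faults if there is no such splitting. - In $\Gamma\vdash\mathcal C$ (client-local), conversely, a call gives up a state in $p_t$ (faulting if there is none) and a return receives any compatible state in $q_t$. The semantics of a program from $\sigma$ is $\top$ if some trace in its trace set evaluates to $\top$ from $\sigma$, and otherwise the set of the (annotated) traces obtained by evaluating the traces in its trace set. A program is *safe for* $I\subseteq\Sigma$ if its semantics is not $\top$ from any $\sigma\in I$; $[\![\mathcal P,I]\!]$ is the set of pairs $(\sigma,\tau)$ with $\sigma\in I$ and $\tau$ in the semantics of $\mathcal P$ from $\sigma$. $\mathsf{history}(\tau)$ is the projection of $\tau$ to call and return actions. $\mathsf{client}(\tau)$ is the projection of $\tau$ to call and return actions and those $(t,c)$ at which every earlier call action by $t$ has been followed by a return action by $t$. **Linearizability with ownership transfer.** For sequences $H,H'$ of annotated calls and returns, $H\sqsubseteq H'$ if there is a bijection $\rho:\{1,\dots,|H|\}\to\{1,\dots,|H'|\}$ such that $H(i)=H'(\rho(i))$ for all $i$, and $\rho(i)<\rho(j)$ whenever $i<j$ and either $H(i),H(j)$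 are by the same thread or $H(i)$ is a return and $H(j)$ is a call. $(\mathcal L_1:\Gamma,I_1)\sqsubseteq(\mathcal L_2:\Gamma,I_2)$ means: for every $(\sigma_1,\lambda_1)\in[\![\mathcal L_1:\Gamma,I_1]\!]$ there is $(\sigma_2,\lambda_2)\in[\![\mathcal L_2:\Gamma,I_2]\!]$ with $\delta(\sigma_2)\preceq\delta(\sigma_1)$ and $\mathsf{history}(\lambda_1)\sqsubseteq\mathsf{history}(\lambda_2)$. **Theorem (Abstraction: specification by code).** Let $I,I_1,I_2\subseteq\Sigma$. If $\mathcal L_1:\Gamma$, $\mathcal L_2:\Gamma$ and $\Gamma\vdash\mathcal C$ are safe for $I_1$, $I_2$ and $I$, respectively, and $(\mathcal L_1:\Gamma,I_1)\sqsubseteq(\mathcal L_2:\Gamma,I_2)$, then - $\mathcal C(\mathcal L_1)$ and $\mathcal C(\mathcal L_2)$ are safe for $I*I_1$ and $I*I_2$, respectively, and - for every $(\sigma_1,\tau_1)\in[\![\mathcal C(\mathcal L_1),I*I_1]\!]$ there is $(\sigma_2,\tau_2)\in[\![\mathcal C(\mathcal L_2),I*I_2]\!]$ with $\mathsf{client}(\tau_1)=\mathsf{client}(\tau_2)$.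 -/

import Mathlib

namespace OwnershipTransfer

/-! ## Separation algebras and footprints -/

/-- A separation algebra: a partial commutative, associative, cancellative operation with a unit.
`op a b = none` means that `a * b` is undefined; equalities between `Option` values are the
equalities "both sides are undefined, or both are defined and equal". -/
class SepAlgebra (S : Type*) where
  op : S → S → Option S
  unit : S
  op_comm : ∀ a b, op a b = op b a
  op_assoc : ∀ a b c, (op a b).bind (fun x => op x c) = (op b c).bind (fun x => op a x)
  unit_op : ∀ a, op unit a = some a
  op_cancel : ∀ a b c d, op a b = some d → op a c = some d → b = c

/-- The pointwise lifting of `*` to sets of states. -/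
def setOp {S : Type*} [SepAlgebra S] (p q : Set S) : Set S :=
  {σ | ∃ σ₁ ∈ p, ∃ σ₂ ∈ q, SepAlgebra.op σ₁ σ₂ = some σ}

/-- `σ₁ * σ₂` is defined. -/
def Compatible {S : Type*} [SepAlgebra S] (σ₁ σ₂ : S) : Prop :=
  ∃ σ, SepAlgebra.op σ₁ σ₂ = some σ

/-- The footprint `δ(σ)` of a state. -/
def foot {S : Type*} [SepAlgebra S] (σ : S) : Set S :=
  {σ' | ∀ σ'', Compatible σ' σ'' ↔ Compatible σ σ''}

/-- `*` is cancellative on footprints. -/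
def CancellativeOnFootprints (S : Type*) [SepAlgebra S] : Prop :=
  ∀ σ₁ σ₂ σ σ₁' σ₂' σ' : S,
    SepAlgebra.op σ₁ σ₂ = some σ → SepAlgebra.op σ₁' σ₂' = some σ' →
    foot σ = foot σ' → foot σ₁ = foot σ₁' → foot σ₂ = foot σ₂'

/-- The footprint `l₁` is smaller than `l₂`: the footprint subtraction of `l₁` from `l₂` is
defined, that is, some states `σ₁`, `σ₂` of these footprints satisfy `σ₂ = σ₁ * σ`. -/
def FootLE {S : Type*} [SepAlgebra S] (l₁ l₂ : Set S) : Prop :=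
  ∃ σ₁ σ₂ σ : S, l₁ = foot σ₁ ∧ l₂ = foot σ₂ ∧ SepAlgebra.op σ₁ σ = some σ₂

/-! ## Results of evaluation and primitive commands -/

/-- An element of `2^α ∪ {⊤}`; `fault` is the error element `⊤`. -/
inductive Outcome (α : Type*) where
  | fault : Outcome α
  | ok : Set α → Outcome α

/-- Thread identifiers. The threads of an `n`-fold parallel composition are `0, …, n - 1`. -/
abbrev ThreadID : Type := ℕ

/-- An interpretation of primitive commands as state transformers indexed by the executing
thread. -/
abbrev Transformers (S PComm : Type*) := ThreadID → PComm → S → Outcome S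

/-- Primitive commands preserve footprints. -/
def FootprintPreserving {S PComm : Type*} [SepAlgebra S] (f : Transformers S PComm) : Prop :=
  ∀ t c σ p, f t c σ = .ok p → ∀ σ' ∈ p, foot σ' = foot σ

/-- If `c` does not fault from `σ₁` and `σ₁ * σ₂ = σ`, then `f(σ) = f(σ₁) * {σ₂}`. -/
def StronglyLocal {S PComm : Type*} [SepAlgebra S] (f : Transformers S PComm) : Prop :=
  ∀ t c σ₁ σ₂ σ p, SepAlgebra.op σ₁ σ₂ = some σ → f t c σ₁ = .ok p →
    f t c σ = .ok (setOp p {σ₂})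

/-! ## Syntax of programs -/

/-- Commands: `c`, `m`, `C; C'`, `C + C'` and `C*`. -/
inductive Cmd (PComm Method : Type*) where
  | prim : PComm → Cmd PComm Method
  | call : Method → Cmd PComm Method
  | seq : Cmd PComm Method → Cmd PComm Method → Cmd PComm Method
  | choice : Cmd PComm Method → Cmd PComm Method → Cmd PComm Method
  | star : Cmd PComm Method → Cmd PComm Method

/-- The set of methods called by a command. -/
def Cmd.methods {PComm Method : Type*} : Cmd PComm Method → Set Method
  | .prim _ => ∅
  | .call m => {m}
  | .seq C₁ C₂ => C₁.methods ∪ C₂.methods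
  | .choice C₁ C₂ => C₁.methods ∪ C₂.methods
  | .star C => C.methods

/-- A library: a partial map from method names to method bodies. -/
abbrev Library (PComm Method : Type*) := Method → Option (Cmd PComm Method)

/-- A client: a parallel composition of `n` threads. -/
abbrev Client (PComm Method : Type*) (n : ℕ) := Fin n → Cmd PComm Method

/-! ## Method specifications -/

/-- A triple `{p} m {q}` for a fixed method: `p` and `q` are predicates parameterised by
thread identifiers. -/
structure MethodSpec (S : Type*) where
  pre : ThreadID → Set S
  post : ThreadID → Set S

/-- A method specification: at most one triple for each method. -/
abbrev Spec (S Method : Type*) := Method → Option (MethodSpec S)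

/-- Every state has at most one substate in the predicate `r`. -/
def PrecisePred {S : Type*} [SepAlgebra S] (r : Set S) : Prop :=
  ∀ σ, ∀ σ₁ ∈ r, ∀ σ₁' ∈ r,
    (∃ σ₂, SepAlgebra.op σ₁ σ₂ = some σ) → (∃ σ₂', SepAlgebra.op σ₁' σ₂' = some σ) → σ₁ = σ₁'

/-- All pre- and postconditions in `Γ` are precise. -/
def PreciseSpec {S Method : Type*} [SepAlgebra S] (Γ : Spec S Method) : Prop :=
  ∀ m s, Γ m = some s → ∀ t, PrecisePred (s.pre t) ∧ PrecisePred (s.post t)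

/-- `L : Γ` is a specified open program: `Γ` specifies exactly the methods implemented by `L`,
and there are no nested method calls. -/
def LibraryHasSpec {S PComm Method : Type*} (L : Library PComm Method) (Γ : Spec S Method) :
    Prop :=
  (∀ m, (L m).isSome ↔ (Γ m).isSome) ∧ ∀ m C, L m = some C → C.methods = ∅

/-- `Γ ⊢ C` is a specified open program: `Γ` specifies all the methods that `C` may call. -/
def ClientHasSpec {S PComm Method : Type*} {n : ℕ} (Γ : Spec S Method)
    (C : Client PComm Method n) : Prop :=
  ∀ t, ∀ m ∈ (C t).methods, (Γ m).isSome

/-! ## Actions and traces -/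

/-- Call and return actions annotated with elements of `A`. With `A = S` these are the interface
actions `(t, call m(σ))` and `(t, ret m(σ))`; with `A = Unit` they are the unannotated actions
`(t, call m)` and `(t, ret m)`. -/
inductive CallRetAct (A Method : Type*) where
  | call : ThreadID → Method → A → CallRetAct A Method
  | ret : ThreadID → Method → A → CallRetAct A Method

/-- Actions: calls and returns (annotated by elements of `A`), and primitive commands. -/
inductive Act (A PComm Method : Type*) where
  | iface : CallRetAct A Method → Act A PComm Method
  | prim : ThreadID → PComm → Act A PComm Method

def CallRetAct.tid {A Method : Type*} : CallRetAct A Method → ThreadID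
  | .call t _ _ => t
  | .ret t _ _ => t

def CallRetAct.IsCall {A Method : Type*} : CallRetAct A Method → Prop
  | .call _ _ _ => True
  | .ret _ _ _ => False

def CallRetAct.IsRet {A Method : Type*} : CallRetAct A Method → Prop
  | .call _ _ _ => False
  | .ret _ _ _ => True

def Act.tid {A PComm Method : Type*} : Act A PComm Method → ThreadID
  | .iface ψ => ψ.tid
  | .prim t _ => t

abbrev Trace (A PComm Method : Type*) := List (Act A PComm Method)

/-- The projection `τ|_t` of a trace to the actions of thread `t`. -/
def threadProj {A PComm Method : Type*} (τ : Trace A PComm Method) (t : ThreadID) :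
    Trace A PComm Method :=
  τ.filter (fun φ => decide (φ.tid = t))

/-- The projection of a trace to call and return actions. -/
def history {A PComm Method : Type*} (τ : Trace A PComm Method) : List (CallRetAct A Method) :=
  τ.filterMap (fun φ => match φ with
    | .iface ψ => some ψ
    | .prim _ _ => none)

/-- After the trace `π`, thread `t` is inside a method: `π` contains a call action by `t` that
is not followed in `π` by a return action by `t`. -/
def InMethod {A PComm Method : Type*} (π : Trace A PComm Method) (t : ThreadID) : Prop :=
  ∃ π₁ π₂ m a, π = π₁ ++ Act.iface (.call t m a) :: π₂ ∧
    ∀ m' a', Act.iface (.ret t m' a') ∉ π₂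

open Classical in
/-- The projection of `τ` to client, call and return actions, where `π` is the part of the trace
that precedes `τ`. An action `(t, c)` is a client action if `t` is not inside a method. -/
noncomputable def clientAfter {A PComm Method : Type*} (π : Trace A PComm Method) :
    Trace A PComm Method → Trace A PComm Method
  | [] => []
  | .iface ψ :: τ => .iface ψ :: clientAfter (π ++ [.iface ψ]) τ
  | .prim t c :: τ =>
      if InMethod π t then clientAfter (π ++ [.prim t c]) τ
      else .prim t c :: clientAfter (π ++ [.prim t c]) τ

/-- The projection `client(τ)` of a trace to client, call and return actions. -/
noncomputable def client {A PComm Method : Type*} (τ : Trace A PComm Method) :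
    Trace A PComm Method :=
  clientAfter [] τ

/-! ## Trace sets -/

/-- Finite concatenations of elements of `T`. -/
def starSet {α : Type*} (T : Set (List α)) : Set (List α) :=
  {τ | ∃ ts : List (List α), (∀ x ∈ ts, x ∈ T) ∧ τ = ts.flatten}

/-- The prefix closure. -/
def prefixClosure {α : Type*} (T : Set (List α)) : Set (List α) :=
  {τ | ∃ τ' ∈ T, τ <+: τ'}

/-- The traces of a method call whose body has the trace set `T`. -/
def callTraces {PComm Method : Type*} (t : ThreadID) (m : Method)
    (T : Set (Trace Unit PComm Method)) : Set (Trace Unit PComm Method) :=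
  {τ | ∃ τ' ∈ T, τ = Act.iface (.call t m ()) :: (τ' ++ [Act.iface (.ret t m ())])}

/-- The trace set of a command executed by thread `t`, where `η` gives the trace sets of the
method bodies. -/
def Cmd.traces {PComm Method : Type*} (η : Method → ThreadID → Set (Trace Unit PComm Method))
    (t : ThreadID) : Cmd PComm Method → Set (Trace Unit PComm Method)
  | .prim c => {[Act.prim t c]}
  | .call m => callTraces t m (η m t)
  | .seq C₁ C₂ => {τ | ∃ τ₁ ∈ C₁.traces η t, ∃ τ₂ ∈ C₂.traces η t, τ = τ₁ ++ τ₂}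
  | .choice C₁ C₂ => C₁.traces η t ∪ C₂.traces η t
  | .star C => starSet (C.traces η t)

/-- All interleavings of traces of the threads `0, …, n - 1`, where `T t` is the trace set of
thread `t`. -/
def parTraces {PComm Method : Type*} (n : ℕ) (T : ThreadID → Set (Trace Unit PComm Method)) :
    Set (Trace Unit PComm Method) :=
  {τ | (∀ φ ∈ τ, φ.tid < n) ∧ ∀ t < n, threadProj τ t ∈ T t}

/-- The trace set of `C₁ ∥ … ∥ Cₙ`. -/
def Client.traces {PComm Method : Type*} {n : ℕ}
    (η : Method → ThreadID → Set (Trace Unit PComm Method)) (C : Client PComm Method n) :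
    Set (Trace Unit PComm Method) :=
  parTraces n (fun t => {τ | ∃ h : t < n, τ ∈ (C ⟨t, h⟩).traces η t})

/-- The trace sets of the method bodies of a library. Bodies call no methods, so the trace sets
chosen for nested calls are irrelevant. -/
def Library.bodyTraces {PComm Method : Type*} (L : Library PComm Method) (m : Method)
    (t : ThreadID) : Set (Trace Unit PComm Method) :=
  {τ | ∃ C, L m = some C ∧ τ ∈ C.traces (fun _ _ => ∅) t}

/-- The trace set of the complete program `let L in C₁ ∥ … ∥ Cₙ`. -/
def completeTraces {PComm Method : Type*} {n : ℕ} (L : Library PComm Method)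
    (C : Client PComm Method n) : Set (Trace Unit PComm Method) :=
  prefixClosure (Client.traces (Library.bodyTraces L) C)

/-- The trace set of the client `let [-] in C₁ ∥ … ∥ Cₙ`: method bodies are empty. -/
def clientTraces {PComm Method : Type*} {n : ℕ} (C : Client PComm Method n) :
    Set (Trace Unit PComm Method) :=
  prefixClosure (Client.traces (fun _ _ => {[]}) C)

/-- The trace set of one thread of the most general client `(m₁ + … + mⱼ)*`, where `m₁, …, mⱼ`
are the methods of the library. -/
def mgcTraces {PComm Method : Type*} (L : Library PComm Method) (t : ThreadID) :
    Set (Trace Unit PComm Method) :=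
  starSet {τ | ∃ m, (L m).isSome ∧ τ ∈ callTraces t m (Library.bodyTraces L m t)}

/-- The trace set of a library: it is run by `k ≥ 1` copies of its most general client. -/
def libraryTraces {PComm Method : Type*} (L : Library PComm Method) :
    Set (Trace Unit PComm Method) :=
  prefixClosure {τ | ∃ k, 1 ≤ k ∧ τ ∈ parTraces k (mgcTraces L)}

/-! ## Evaluation of actions -/

/-- An evaluation of unannotated actions, yielding states and actions annotated by `A`. -/
abbrev ActEval (S A PComm Method : Type*) :=
  Act Unit PComm Method → S → Outcome (S × Act A PComm Method)

/-- Evaluation of `(t, c)`. -/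
def evalPrim {S A PComm Method : Type*} (f : Transformers S PComm) (t : ThreadID) (c : PComm)
    (σ : S) : Outcome (S × Act A PComm Method) :=
  match f t c σ with
  | .fault => .fault
  | .ok p => .ok {x | x.1 ∈ p ∧ x.2 = Act.prim t c}

/-- The component receives an arbitrary compatible piece of state satisfying `r`. -/
def receive {S A : Type*} [SepAlgebra S] (r : Set S) (mk : S → A) (σ : S) : Outcome (S × A) :=
  .ok {x | ∃ σr ∈ r, SepAlgebra.op σ σr = some x.1 ∧ x.2 = mk σr}

open Classical in
/-- The component gives up the piece of its state satisfying `r`, and faults if there is none.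
For a precise `r` this piece is unique, and then so is the remaining state. -/
noncomputable def giveUp {S A : Type*} [SepAlgebra S] (r : Set S) (mk : S → A) (σ : S) :
    Outcome (S × A) :=
  if ∃ σr ∈ r, ∃ σ', SepAlgebra.op σ' σr = some σ then
    .ok {x | ∃ σr ∈ r, SepAlgebra.op x.1 σr = some σ ∧ x.2 = mk σr}
  else .fault

/-- Evaluation of actions in a complete program: calls and returns do nothing. -/
def evalComplete {S PComm Method : Type*} (f : Transformers S PComm) :
    ActEval S Unit PComm Method
  | .prim t c, σ => evalPrim f t c σ
  | .iface ψ, σ => .ok {(σ, Act.iface ψ)}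

/-- Library-local evaluation of actions: the library receives state at calls and gives up state
at returns. Methods outside `Γ` do not occur in traces of a library `L : Γ`. -/
noncomputable def evalLibrary {S PComm Method : Type*} [SepAlgebra S] (f : Transformers S PComm)
    (Γ : Spec S Method) : ActEval S S PComm Method
  | .prim t c, σ => evalPrim f t c σ
  | .iface (.call t m _), σ =>
      match Γ m with
      | none => .fault
      | some s => receive (s.pre t) (fun σp => Act.iface (.call t m σp)) σ
  | .iface (.ret t m _), σ =>
      match Γ m with
      | none => .fault
      | some s => giveUp (s.post t) (fun σq => Act.iface (.ret t m σq)) σ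

/-- Client-local evaluation of actions: the client gives up state at calls and receives state
at returns. Methods outside `Γ` do not occur in traces of a client `Γ ⊢ C`. -/
noncomputable def evalClient {S PComm Method : Type*} [SepAlgebra S] (f : Transformers S PComm)
    (Γ : Spec S Method) : ActEval S S PComm Method
  | .prim t c, σ => evalPrim f t c σ
  | .iface (.call t m _), σ =>
      match Γ m with
      | none => .fault
      | some s => giveUp (s.pre t) (fun σp => Act.iface (.call t m σp)) σ
  | .iface (.ret t m _), σ =>
      match Γ m with
      | none => .fault
      | some s => receive (s.post t) (fun σq => Act.iface (.ret t m σq)) σ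

/-! ## Evaluation of traces and programs -/

open Classical in
/-- The evaluation of `τφ` from that of `τ`. -/
noncomputable def evalStep {S A PComm Method : Type*} (ev : ActEval S A PComm Method) :
    Outcome (S × Trace A PComm Method) → Act Unit PComm Method →
      Outcome (S × Trace A PComm Method)
  | .fault, _ => .fault
  | .ok X, φ =>
      if ∃ x ∈ X, ev φ x.1 = .fault then .fault
      else .ok {y | ∃ x ∈ X, ∃ Z, ev φ x.1 = .ok Z ∧
        ∃ φ', (y.1, φ') ∈ Z ∧ y.2 = x.2 ++ [φ']}

/-- The evaluation of a trace from the state `σ`: final states with annotated traces, or a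
fault. -/
noncomputable def evalTrace {S A PComm Method : Type*} (ev : ActEval S A PComm Method)
    (τ : Trace Unit PComm Method) (σ : S) : Outcome (S × Trace A PComm Method) :=
  τ.foldl (evalStep ev) (.ok {(σ, [])})

open Classical in
/-- The denotation, from the initial state `σ`, of a program with trace set `T`. -/
noncomputable def denote {S A PComm Method : Type*} (ev : ActEval S A PComm Method)
    (T : Set (Trace Unit PComm Method)) (σ : S) : Outcome (Trace A PComm Method) :=
  if ∃ τ ∈ T, evalTrace ev τ σ = .fault then .fault
  else .ok {τ' | ∃ τ ∈ T, ∃ X, evalTrace ev τ σ = .ok X ∧ ∃ σ', (σ', τ') ∈ X}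

/-- The semantics of the complete program `C(L)`. -/
noncomputable def completeSem {S PComm Method : Type*} (f : Transformers S PComm) {n : ℕ}
    (C : Client PComm Method n) (L : Library PComm Method) :
    S → Outcome (Trace Unit PComm Method) :=
  denote (evalComplete f) (completeTraces L C)

/-- The library-local semantics of `L : Γ`. -/
noncomputable def librarySem {S PComm Method : Type*} [SepAlgebra S] (f : Transformers S PComm)
    (L : Library PComm Method) (Γ : Spec S Method) : S → Outcome (Trace S PComm Method) :=
  denote (evalLibrary f Γ) (libraryTraces L)

/-- The client-local semantics of `Γ ⊢ C`. -/
noncomputable def clientSem {S PComm Method : Type*} [SepAlgebra S] (f : Transformers S PComm)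
    (Γ : Spec S Method) {n : ℕ} (C : Client PComm Method n) :
    S → Outcome (Trace S PComm Method) :=
  denote (evalClient f Γ) (clientTraces C)

/-- A program with semantics `D` is safe for a set `I` of initial states. -/
def Safe {S α : Type*} (D : S → Outcome α) (I : Set S) : Prop :=
  ∀ σ ∈ I, D σ ≠ .fault

/-- Pairs of an initial state in `I` and a trace produced from it by a program with
semantics `D`. -/
def runs {S α : Type*} (D : S → Outcome α) (I : Set S) : Set (S × α) :=
  {x | x.1 ∈ I ∧ ∃ X, D x.1 = .ok X ∧ x.2 ∈ X}

/-! ## Linearizability -/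

/-- The linearization relation on histories: `H'` is a permutation of `H` preserving the order
of actions within threads and the order of returns and subsequent calls. -/
def HistLin {S Method : Type*} (H H' : List (CallRetAct S Method)) : Prop :=
  ∃ ρ : Fin H.length ≃ Fin H'.length, ∀ i j,
    H.get i = H'.get (ρ i) ∧
    (i < j ∧ ((H.get i).tid = (H.get j).tid ∨ ((H.get i).IsRet ∧ (H.get j).IsCall)) →
      ρ i < ρ j)

/-- The linearization relation on pairs of an initial footprint and a history, lifted to sets
of such pairs. -/
def InterfLin {S Method : Type*} [SepAlgebra S]
    (X₁ X₂ : Set (Set S × List (CallRetAct S Method))) : Prop :=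
  ∀ x₁ ∈ X₁, ∃ x₂ ∈ X₂, FootLE x₂.1 x₁.1 ∧ HistLin x₁.2 x₂.2

/-- The interface set of a library `L : Γ` run from initial states in `I`. -/
def interf {S PComm Method : Type*} [SepAlgebra S] (f : Transformers S PComm)
    (L : Library PComm Method) (Γ : Spec S Method) (I : Set S) :
    Set (Set S × List (CallRetAct S Method)) :=
  {x | ∃ y ∈ runs (librarySem f L Γ) I, x = (foot y.1, history y.2)}

/-- `(L₁ : Γ, I₁)` is linearized by `(L₂ : Γ, I₂)`. -/
def LinearizedBy {S PComm Method : Type*} [SepAlgebra S] (f : Transformers S PComm)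
    (Γ : Spec S Method) (L₁ : Library PComm Method) (I₁ : Set S)
    (L₂ : Library PComm Method) (I₂ : Set S) : Prop :=
  InterfLin (interf f L₁ Γ I₁) (interf f L₂ Γ I₂)

end OwnershipTransfer

open OwnershipTransfer

/-! A run of C(L₁) is a client run and a library run side by side. The state is a product of a
client state and a library state. By strong locality, each command acts on the factor of the
component it belongs to and leaves the other as a frame, while a call or return moves a piece from
one factor to the other without changing the product. Faults of the composition would be faults of a
component, which gives both safety claims (`Decomposes.step`). The two local runs of a run of C(L₁)
have the same history, so linearizability supplies a run ξ of L₂ whose history is a permutation of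
it.

The client run κ is then replayed against ξ on demand (`Simulates`). Commands and calls of the
client are executed at once, even if ξ makes the call later. When the client expects a return, ξ is
run until it has made that return, and other returns met on the way are held back. A call met on the
way has already been made by the client: the expected return precedes every call the client has
still to make, and linearization keeps that order (`Reorders.mem_of_head`). The actual library state
is thus the state of ξ plus the pieces of the early calls E and of the late returns D. These form a
frame under which the commands of ξ still run, by strong locality and footprint preservation.

Footprints relate the two libraries. In the replay the library of C(L₂) undergoes the same
transfers, in the same order, as that of C(L₁), and commands do not change footprints, so the
initial comparison `FootBelow` persists: at calls by congruence, at returns by cancellativity on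
footprints. It supplies the initial product state and the compatibility of each piece handed over at
a call (`JointRun.exists_simulates`).

The replayed trace is a trace of C(L₂) because membership can be tested on its client part and its
library part separately (`mem_completeTraces_of_parts`). The client part is that of the original
trace. The library part is, on each thread, a prefix of ξ, or a prefix followed by one new call,
which the most general client permits. -/

namespace OwnershipTransfer

open SepAlgebra

/-! ### Footprint comparison and framing by lists of states -/

section Algebra

variable {S : Type*} [SepAlgebra S]

theorem op_comm_of {a b c : S} (h : op a b = some c) : op b a = some c := by
  rw [op_comm, h]

theorem op_assoc_left {a b c ab abc : S} (h₁ : op a b = some ab) (h₂ : op ab c = some abc) :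
    ∃ bc, op b c = some bc ∧ op a bc = some abc := by
  have h := op_assoc a b c
  rw [h₁, Option.bind_some, h₂] at h
  exact Option.bind_eq_some_iff.1 h.symm

theorem op_assoc_right {a b c bc abc : S} (h₁ : op b c = some bc) (h₂ : op a bc = some abc) :
    ∃ ab, op a b = some ab ∧ op ab c = some abc := by
  have h := op_assoc a b c
  rw [h₁, Option.bind_some, h₂] at h
  exact Option.bind_eq_some_iff.1 h

theorem op_right_comm {a b c ab abc : S} (h₁ : op a b = some ab) (h₂ : op ab c = some abc) :
    ∃ ac, op a c = some ac ∧ op ac b = some abc := by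
  obtain ⟨bc, h, h'⟩ := op_assoc_left h₁ h₂
  exact op_assoc_right (op_comm_of h) h'

theorem foot_eq_iff {a b : S} : foot a = foot b ↔ ∀ z, Compatible a z ↔ Compatible b z := by
  constructor
  · intro h
    have : a ∈ foot b := h ▸ fun _ => Iff.rfl
    exact this
  · intro h
    ext x
    exact forall_congr' fun z => by rw [h z]

theorem Compatible.of_foot_eq {a b z : S} (h : foot a = foot b) (hz : Compatible a z) :
    Compatible b z :=
  (foot_eq_iff.1 h z).1 hz

/-- By associativity, `w` is compatible with `a * z` exactly when `z * w` is defined and compatible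
with `a`, which depends on `a` only through its footprint. -/
theorem foot_op_congr {a b z az bz : S} (h : foot a = foot b) (ha : op a z = some az)
    (hb : op b z = some bz) : foot az = foot bz := by
  have aux : ∀ {a b z az bz : S}, foot a = foot b → op a z = some az → op b z = some bz →
      ∀ w, Compatible az w → Compatible bz w := by
    rintro a b z az bz h ha hb w ⟨v, hv⟩
    obtain ⟨zw, h₁, h₂⟩ := op_assoc_left ha hv
    obtain ⟨u, hu⟩ := Compatible.of_foot_eq h ⟨v, h₂⟩
    obtain ⟨bz', h₃, h₄⟩ := op_assoc_right h₁ hu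
    rw [hb] at h₃
    cases h₃
    exact ⟨u, h₄⟩
  exact foot_eq_iff.2 fun w => ⟨aux h ha hb w, aux h.symm hb ha w⟩

/-- The footprint of `a` extended by some state is the footprint of `b`. -/
def FootBelow (a b : S) : Prop :=
  ∃ z y, op a z = some y ∧ foot y = foot b

/-- `FootLE` speaks of some representatives of the footprints; equality of footprints allows the
same extension to be added to `a` itself. -/
theorem FootLE.footBelow {a b : S} (h : FootLE (foot a) (foot b)) : FootBelow a b := by
  obtain ⟨x, y, z, hx, hy, hz⟩ := h
  obtain ⟨w, hw⟩ := Compatible.of_foot_eq hx.symm ⟨y, hz⟩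
  exact ⟨z, w, hw, (foot_op_congr hx hw hz).trans hy.symm⟩

theorem FootBelow.compatible {a b c : S} (h : FootBelow a b) (hb : Compatible b c) :
    Compatible a c := by
  obtain ⟨z, y, hz, hy⟩ := h
  obtain ⟨w, hw⟩ := Compatible.of_foot_eq hy.symm hb
  obtain ⟨ac, h₁, -⟩ := op_right_comm hz hw
  exact ⟨ac, h₁⟩

theorem FootBelow.congr_right {a b b' : S} (h : FootBelow a b) (hb : foot b = foot b') :
    FootBelow a b' := by
  obtain ⟨z, y, hz, hy⟩ := h
  exact ⟨z, y, hz, hy.trans hb⟩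

theorem FootBelow.congr_left {a a' b : S} (h : FootBelow a b) (ha : foot a = foot a') :
    FootBelow a' b := by
  obtain ⟨z, y, hz, hy⟩ := h
  obtain ⟨w, hw⟩ := Compatible.of_foot_eq ha ⟨y, hz⟩
  exact ⟨z, w, hw, (foot_op_congr ha.symm hw hz).trans hy⟩

theorem FootBelow.op_congr {a b c ac bc : S} (h : FootBelow a b) (ha : op a c = some ac)
    (hb : op b c = some bc) : FootBelow ac bc := by
  obtain ⟨z, y, hz, hy⟩ := h
  obtain ⟨w, hw⟩ := Compatible.of_foot_eq hy.symm ⟨bc, hb⟩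
  obtain ⟨ac', h₁, h₂⟩ := op_right_comm hz hw
  rw [ha] at h₁
  cases h₁
  exact ⟨z, w, h₂, foot_op_congr hy hw hb⟩

/-- Commuting the extension `z` past `c` writes the left state as `(a * z) * c`. It has the
footprint of `b * c`, so cancelling `c` on footprints leaves `a * z` with the footprint of `b`. This
is the step that a return needs. -/
theorem FootBelow.cancel (hS : CancellativeOnFootprints S) {a b c ac bc : S}
    (h : FootBelow ac bc) (ha : op a c = some ac) (hb : op b c = some bc) : FootBelow a b := by
  obtain ⟨z, y, hz, hy⟩ := h
  obtain ⟨az, h₁, h₂⟩ := op_right_comm ha hz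
  exact ⟨z, az, h₁, hS c az y c b bc (op_comm_of h₂) (op_comm_of hb) hy rfl⟩

/-- `σ'` is obtained from `σ` by adding the states of a list one after the other. -/
def Adds : S → List S → S → Prop
  | σ, [], σ' => σ = σ'
  | σ, a :: l, σ' => ∃ σ₁, op σ a = some σ₁ ∧ Adds σ₁ l σ'

/-- The client and the library trace transfer the same pieces in different orders; this makes the
order in which pending pieces are listed irrelevant. -/
theorem Adds.perm {l l' : List S} (h : l.Perm l') : ∀ {σ σ' : S}, Adds σ l σ' → Adds σ l' σ' := by
  induction h with
  | nil => exact id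
  | cons a _ ih =>
    rintro σ σ' ⟨σ₁, h₁, h₂⟩
    exact ⟨σ₁, h₁, ih h₂⟩
  | swap a b l =>
    rintro σ σ' ⟨σ₁, h₁, σ₂, h₂, h₃⟩
    obtain ⟨σ₃, h₄, h₅⟩ := op_right_comm h₁ h₂
    exact ⟨σ₃, h₄, σ₂, h₅, h₃⟩
  | trans _ _ ih₁ ih₂ => exact fun h => ih₂ (ih₁ h)

theorem Adds.append_singleton {l : List S} {a : S} : ∀ {σ σ₁ σ' : S}, Adds σ l σ₁ →
    op σ₁ a = some σ' → Adds σ (l ++ [a]) σ' := by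
  induction l with
  | nil =>
    rintro σ σ₁ σ' rfl h
    exact ⟨σ', h, rfl⟩
  | cons b l ih =>
    rintro σ σ₁ σ' ⟨σ₂, h₁, h₂⟩ h
    exact ⟨σ₂, h₁, ih h₂ h⟩

theorem Adds.of_append_singleton {l : List S} {a : S} : ∀ {σ σ' : S}, Adds σ (l ++ [a]) σ' →
    ∃ σ₁, Adds σ l σ₁ ∧ op σ₁ a = some σ' := by
  induction l with
  | nil =>
    rintro σ σ' ⟨σ₁, h, rfl⟩
    exact ⟨σ, rfl, h⟩
  | cons b l ih =>
    rintro σ σ' ⟨σ₂, h₁, h₂⟩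
    obtain ⟨σ₁, h₃, h₄⟩ := ih h₂
    exact ⟨σ₁, ⟨σ₂, h₁, h₃⟩, h₄⟩

/-- A primitive command runs unchanged in the presence of additional state. -/
theorem Transformers.frame {PComm : Type*} {f : Transformers S PComm} (hfp : FootprintPreserving f)
    (hsl : StronglyLocal f) {t : ThreadID} {c : PComm} {σ σ' a σa : S} {p : Set S}
    (hp : f t c σ = .ok p) (hσ' : σ' ∈ p) (ha : op σ a = some σa) :
    ∃ p' σa', f t c σa = .ok p' ∧ σa' ∈ p' ∧ op σ' a = some σa' := by
  obtain ⟨σa', h⟩ := Compatible.of_foot_eq (hfp t c σ p hp σ' hσ').symm ⟨σa, ha⟩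
  exact ⟨_, σa', hsl t c σ a σa p ha hp, ⟨σ', hσ', a, rfl, h⟩, h⟩

/-- Lets a library command run while the pieces of early calls and of postponed returns are also
present in the library state. -/
theorem Adds.frame {PComm : Type*} {f : Transformers S PComm} (hfp : FootprintPreserving f)
    (hsl : StronglyLocal f) {t : ThreadID} {c : PComm} {l : List S} :
    ∀ {σ σ' σl : S} {p : Set S}, f t c σ = .ok p → σ' ∈ p → Adds σ l σl →
      ∃ p' σl', f t c σl = .ok p' ∧ σl' ∈ p' ∧ Adds σ' l σl' := by
  induction l with
  | nil =>
    rintro σ σ' _ p hp hσ' rfl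
    exact ⟨p, σ', hp, hσ', rfl⟩
  | cons a l ih =>
    rintro σ σ' σl p hp hσ' ⟨σ₁, h₁, h₂⟩
    obtain ⟨p', σ₁', h₃, h₄, h₅⟩ := Transformers.frame hfp hsl hp hσ' h₁
    obtain ⟨p'', σl', h₆, h₇, h₈⟩ := ih h₃ h₄ h₂
    exact ⟨p'', σl', h₆, h₇, σ₁', h₅, h₈⟩

end Algebra

/-! ### Trace evaluation as a relation between states -/

section Evaluation

variable {S A PComm Method : Type*}

/-- The action without its annotation. -/
def CallRetAct.erase : CallRetAct A Method → CallRetAct Unit Method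
  | .call t m _ => .call t m ()
  | .ret t m _ => .ret t m ()

/-- The action without its annotation. -/
def Act.erase : Act A PComm Method → Act Unit PComm Method
  | .iface ψ => .iface ψ.erase
  | .prim t c => .prim t c

@[simp] theorem CallRetAct.erase_unit (ψ : CallRetAct Unit Method) : ψ.erase = ψ := by
  cases ψ <;> rfl

@[simp] theorem Act.erase_unit (φ : Act Unit PComm Method) : φ.erase = φ := by
  cases φ <;> simp [Act.erase]

theorem map_erase_unit (τ : Trace Unit PComm Method) : τ.map Act.erase = τ :=
  List.map_id'' Act.erase_unit τ

/-- The annotated trace `τ` can be executed from `σ`, ending in `σ'`. -/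
def Runs (ev : ActEval S A PComm Method) : S → Trace A PComm Method → S → Prop
  | σ, [], σ' => σ = σ'
  | σ, φ :: τ, σ' => ∃ Z σ₁, ev φ.erase σ = .ok Z ∧ (σ₁, φ) ∈ Z ∧ Runs ev σ₁ τ σ'

theorem runs_append {ev : ActEval S A PComm Method} {τ₁ τ₂ : Trace A PComm Method} :
    ∀ {σ σ' : S}, Runs ev σ (τ₁ ++ τ₂) σ' ↔ ∃ σ₁, Runs ev σ τ₁ σ₁ ∧ Runs ev σ₁ τ₂ σ' := by
  induction τ₁ with
  | nil => simp [Runs]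
  | cons φ τ₁ ih =>
    intro σ σ'
    simp only [List.cons_append, Runs, ih]
    constructor
    · rintro ⟨Z, σ₁, h₁, h₂, σ₂, h₃, h₄⟩
      exact ⟨σ₂, ⟨Z, σ₁, h₁, h₂, h₃⟩, h₄⟩
    · rintro ⟨σ₂, ⟨Z, σ₁, h₁, h₂, h₃⟩, h₄⟩
      exact ⟨Z, σ₁, h₁, h₂, σ₂, h₃, h₄⟩

theorem runs_snoc {ev : ActEval S A PComm Method} {τ : Trace A PComm Method}
    {φ : Act A PComm Method} {σ σ' : S} :
    Runs ev σ (τ ++ [φ]) σ' ↔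
      ∃ σ₁ Z, Runs ev σ τ σ₁ ∧ ev φ.erase σ₁ = .ok Z ∧ (σ', φ) ∈ Z := by
  simp only [runs_append, Runs]
  constructor
  · rintro ⟨σ₁, h, Z, _, h₁, h₂, rfl⟩
    exact ⟨σ₁, Z, h, h₁, h₂⟩
  · rintro ⟨σ₁, Z, h, h₁, h₂⟩
    exact ⟨σ₁, h, Z, _, h₁, h₂, rfl⟩

/-- The evaluation only adds annotations to actions. -/
def OnlyAnnotates (ev : ActEval S A PComm Method) : Prop :=
  ∀ φ σ Z y, ev φ σ = .ok Z → y ∈ Z → y.2.erase = φ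

theorem Runs.snoc {ev : ActEval S A PComm Method} {τ : Trace A PComm Method}
    {φ : Act A PComm Method} {σ σ₁ σ' : S} {Z : Set (S × Act A PComm Method)}
    (h : Runs ev σ τ σ₁) (h₁ : ev φ.erase σ₁ = .ok Z) (h₂ : (σ', φ) ∈ Z) :
    Runs ev σ (τ ++ [φ]) σ' :=
  runs_snoc.2 ⟨σ₁, Z, h, h₁, h₂⟩

theorem evalTrace_snoc (ev : ActEval S A PComm Method) (τ : Trace Unit PComm Method)
    (φ : Act Unit PComm Method) (σ : S) :
    evalTrace ev (τ ++ [φ]) σ = evalStep ev (evalTrace ev τ σ) φ := by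
  simp [evalTrace]

/-- Since evaluation only annotates, an annotated trace determines the trace it came from. The
induction is on the last action because evaluation folds from the left. -/
theorem evalTrace_ok {ev : ActEval S A PComm Method} (hev : OnlyAnnotates ev) {σ : S}
    (τ : Trace Unit PComm Method) : ∀ {X}, evalTrace ev τ σ = .ok X →
      X = {x | x.2.map Act.erase = τ ∧ Runs ev σ x.2 x.1} := by
  induction τ using List.reverseRecOn with
  | nil =>
    intro X h
    simp only [evalTrace, List.foldl_nil, Outcome.ok.injEq] at h
    subst h
    ext ⟨σ', τ'⟩
    simp only [Set.mem_singleton_iff, Prod.mk.injEq, List.map_eq_nil_iff, Set.mem_ofPred_eq]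
    constructor
    · rintro ⟨rfl, rfl⟩
      exact ⟨rfl, rfl⟩
    · rintro ⟨rfl, h⟩
      exact ⟨h.symm, rfl⟩
  | append_singleton τ φ ih =>
    intro X h
    rw [evalTrace_snoc] at h
    cases hτ : evalTrace ev τ σ with
    | fault => simp [hτ, evalStep] at h
    | ok Y =>
      rw [hτ, evalStep] at h
      split_ifs at h with hf
      simp only [Outcome.ok.injEq] at h
      subst h
      rw [ih hτ]
      ext ⟨σ', τ'⟩
      constructor
      · rintro ⟨⟨σ₁, τ₁⟩, ⟨h₁, h₂⟩, Z, hZ, φ', hφ', rfl⟩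
        have he : φ'.erase = φ := hev _ _ _ _ hZ hφ'
        refine ⟨by simp [he, h₁], ?_⟩
        exact runs_snoc.2 ⟨σ₁, Z, h₂, he ▸ hZ, hφ'⟩
      · rintro ⟨h₁, h₂⟩
        obtain ⟨τ₁, l, rfl, hτ₁, hl⟩ := List.map_eq_append_iff.1 h₁
        obtain ⟨φ', rfl, rfl⟩ := List.map_eq_singleton_iff.1 hl
        obtain ⟨σ₁, Z, h₃, h₄, h₅⟩ := runs_snoc.1 h₂
        exact ⟨(σ₁, τ₁), ⟨hτ₁, h₃⟩, Z, h₄, φ', h₅, rfl⟩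

/-- No action faults in a state reached from `σ` by executing a trace from `T`. -/
def NeverFaults (ev : ActEval S A PComm Method) (T : Set (Trace Unit PComm Method)) (σ : S) :
    Prop :=
  ∀ (τ : Trace A PComm Method) φ σ', τ.map Act.erase ++ [φ] ∈ T → Runs ev σ τ σ' →
    ev φ σ' ≠ .fault

theorem evalTrace_ne_fault {ev : ActEval S A PComm Method} (hev : OnlyAnnotates ev)
    {T : Set (Trace Unit PComm Method)} (hT : ∀ τ φ, τ ++ [φ] ∈ T → τ ∈ T) {σ : S}
    (h : NeverFaults ev T σ) (τ : Trace Unit PComm Method) :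
    τ ∈ T → evalTrace ev τ σ ≠ .fault := by
  induction τ using List.reverseRecOn with
  | nil => simp [evalTrace]
  | append_singleton τ φ ih =>
    intro hτ hf
    rw [evalTrace_snoc] at hf
    cases hX : evalTrace ev τ σ with
    | fault => exact ih (hT _ _ hτ) hX
    | ok X =>
      rw [hX, evalStep] at hf
      split_ifs at hf with h'
      obtain ⟨x, hx, hf'⟩ := h'
      rw [evalTrace_ok hev τ hX] at hx
      exact h x.2 φ x.1 (hx.1.symm ▸ hτ) hx.2 hf'

/-- A fault arises at the last action of some prefix, in a state reached by running the rest of that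
prefix without a fault; prefix closure keeps this prefix in `T`. -/
theorem denote_ne_fault_iff {ev : ActEval S A PComm Method} (hev : OnlyAnnotates ev)
    {T : Set (Trace Unit PComm Method)} (hT : ∀ τ φ, τ ++ [φ] ∈ T → τ ∈ T) {σ : S} :
    denote ev T σ ≠ .fault ↔ NeverFaults ev T σ := by
  have hd : denote ev T σ ≠ .fault ↔ ∀ τ ∈ T, evalTrace ev τ σ ≠ .fault := by
    rw [denote]
    split_ifs with h
    · simp only [ne_eq, not_true_eq_false, false_iff]
      push Not
      exact h
    · push Not at h
      simpa using h
  rw [hd]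
  refine ⟨fun h τ φ σ' hτ hr hf => h _ hτ ?_, fun h => evalTrace_ne_fault hev hT h⟩
  rw [evalTrace_snoc]
  cases hX : evalTrace ev (τ.map Act.erase) σ with
  | fault => rfl
  | ok X =>
    rw [evalStep, if_pos]
    refine ⟨(σ', τ), ?_, hf⟩
    rw [evalTrace_ok hev _ hX]
    exact ⟨rfl, hr⟩

theorem mem_denote {ev : ActEval S A PComm Method} (hev : OnlyAnnotates ev)
    {T : Set (Trace Unit PComm Method)} {σ : S} (h : denote ev T σ ≠ .fault)
    {τ : Trace A PComm Method} :
    (∃ X, denote ev T σ = .ok X ∧ τ ∈ X) ↔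
      τ.map Act.erase ∈ T ∧ ∃ σ', Runs ev σ τ σ' := by
  rw [denote] at h ⊢
  split_ifs at h ⊢ with hf
  · exact absurd rfl h
  push Not at hf
  simp only [Outcome.ok.injEq, exists_eq_left', Set.mem_ofPred_eq]
  constructor
  · rintro ⟨τ', hτ', X, hX, σ', hσ'⟩
    rw [evalTrace_ok hev _ hX] at hσ'
    obtain ⟨h₁, h₂⟩ := hσ'
    exact ⟨by rwa [← h₁] at hτ', σ', h₂⟩
  · rintro ⟨hτ, σ', hr⟩
    cases hX : evalTrace ev (τ.map Act.erase) σ with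
    | fault => exact absurd hX (hf _ hτ)
    | ok X =>
      refine ⟨_, hτ, X, hX, σ', ?_⟩
      rw [evalTrace_ok hev _ hX]
      exact ⟨rfl, hr⟩

theorem evalPrim_ok {f : Transformers S PComm} {t : ThreadID} {c : PComm} {σ : S}
    {Z : Set (S × Act A PComm Method)} (h : evalPrim f t c σ = .ok Z) :
    ∃ p, f t c σ = .ok p ∧ Z = {x | x.1 ∈ p ∧ x.2 = Act.prim t c} := by
  rw [evalPrim] at h
  split at h
  · cases h
  · next p hp => exact ⟨p, hp, by simpa using h.symm⟩

theorem evalPrim_of_ok {f : Transformers S PComm} {t : ThreadID} {c : PComm} {σ : S} {p : Set S}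
    (h : f t c σ = .ok p) :
    evalPrim (A := A) (Method := Method) f t c σ = .ok {x | x.1 ∈ p ∧ x.2 = Act.prim t c} := by
  simp [evalPrim, h]

theorem ok_of_ne_fault {α : Type*} {x : Outcome α} (h : x ≠ .fault) : ∃ p, x = .ok p := by
  cases x with
  | fault => exact absurd rfl h
  | ok p => exact ⟨p, rfl⟩

theorem evalPrim_ne_fault {f : Transformers S PComm} {t : ThreadID} {c : PComm}
    {σ : S} (h : evalPrim (A := A) (Method := Method) f t c σ ≠ .fault) :
    ∃ p, f t c σ = .ok p := by
  obtain ⟨Z, hZ⟩ := ok_of_ne_fault h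
  obtain ⟨p, hp, -⟩ := evalPrim_ok hZ
  exact ⟨p, hp⟩

theorem onlyAnnotates_evalComplete (f : Transformers S PComm) :
    OnlyAnnotates (evalComplete (Method := Method) f) := by
  rintro (ψ | ⟨t, c⟩) σ Z ⟨σ', φ⟩ h hφ
  all_goals rw [Act.erase_unit]
  · simp only [evalComplete, Outcome.ok.injEq] at h
    subst h
    exact (Prod.ext_iff.1 hφ).2
  · obtain ⟨p, -, rfl⟩ := evalPrim_ok h
    exact hφ.2

variable [SepAlgebra S]

theorem receive_eq_ok {r : Set S} {mk : S → A} {σ : S} {Z : Set (S × A)}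
    (h : receive r mk σ = .ok Z) :
    Z = {x | ∃ σr ∈ r, SepAlgebra.op σ σr = some x.1 ∧ x.2 = mk σr} := by
  simpa [receive] using h.symm

theorem giveUp_eq_ok {r : Set S} {mk : S → A} {σ : S} {Z : Set (S × A)}
    (h : giveUp r mk σ = .ok Z) :
    (∃ σr ∈ r, ∃ σ', SepAlgebra.op σ' σr = some σ) ∧
      Z = {x | ∃ σr ∈ r, SepAlgebra.op x.1 σr = some σ ∧ x.2 = mk σr} := by
  rw [giveUp] at h
  split_ifs at h with hr
  exact ⟨hr, by simpa using h.symm⟩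

theorem onlyAnnotates_evalLibrary (f : Transformers S PComm) (Γ : Spec S Method) :
    OnlyAnnotates (evalLibrary f Γ) := by
  rintro ((⟨t, m, a⟩ | ⟨t, m, a⟩) | ⟨t, c⟩) σ Z ⟨σ', φ⟩ h hφ
  · simp only [evalLibrary] at h
    split at h
    · cases h
    · rw [receive_eq_ok h] at hφ
      obtain ⟨σr, -, -, h'⟩ := hφ
      simp only at h'
      subst h'
      rfl
  · simp only [evalLibrary] at h
    split at h
    · cases h
    · rw [(giveUp_eq_ok h).2] at hφ
      obtain ⟨σr, -, -, h'⟩ := hφ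
      simp only at h'
      subst h'
      rfl
  · obtain ⟨p, -, rfl⟩ := evalPrim_ok h
    simp only [Set.mem_ofPred_eq] at hφ
    simp [hφ.2, Act.erase]

theorem onlyAnnotates_evalClient (f : Transformers S PComm) (Γ : Spec S Method) :
    OnlyAnnotates (evalClient f Γ) := by
  rintro ((⟨t, m, a⟩ | ⟨t, m, a⟩) | ⟨t, c⟩) σ Z ⟨σ', φ⟩ h hφ
  · simp only [evalClient] at h
    split at h
    · cases h
    · rw [(giveUp_eq_ok h).2] at hφ
      obtain ⟨σr, -, -, h'⟩ := hφ
      simp only at h'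
      subst h'
      rfl
  · simp only [evalClient] at h
    split at h
    · cases h
    · rw [receive_eq_ok h] at hφ
      obtain ⟨σr, -, -, h'⟩ := hφ
      simp only at h'
      subst h'
      rfl
  · obtain ⟨p, -, rfl⟩ := evalPrim_ok h
    simp only [Set.mem_ofPred_eq] at hφ
    simp [hφ.2, Act.erase]

end Evaluation

/-! ### Client and library parts of a trace, globally and per thread -/

section Projections

variable {A PComm Method : Type*}

def CallRetAct.isCall : CallRetAct A Method → Bool
  | .call _ _ _ => true
  | .ret _ _ _ => false

@[simp] theorem CallRetAct.tid_erase (ψ : CallRetAct A Method) : ψ.erase.tid = ψ.tid := by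
  cases ψ <;> rfl

@[simp] theorem CallRetAct.isCall_erase (ψ : CallRetAct A Method) :
    ψ.erase.isCall = ψ.isCall := by
  cases ψ <;> rfl

@[simp] theorem Act.tid_erase (φ : Act A PComm Method) : φ.erase.tid = φ.tid := by
  cases φ <;> simp [Act.erase, Act.tid]

theorem threadProj_append (τ₁ τ₂ : Trace A PComm Method) (t : ThreadID) :
    threadProj (τ₁ ++ τ₂) t = threadProj τ₁ t ++ threadProj τ₂ t :=
  List.filter_append ..

theorem threadProj_cons_of_eq {φ : Act A PComm Method} {t : ThreadID} (h : φ.tid = t)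
    (τ : Trace A PComm Method) : threadProj (φ :: τ) t = φ :: threadProj τ t := by
  simp [threadProj, h]

theorem threadProj_cons_of_ne {φ : Act A PComm Method} {t : ThreadID} (h : φ.tid ≠ t)
    (τ : Trace A PComm Method) : threadProj (φ :: τ) t = threadProj τ t := by
  simp [threadProj, h]

theorem threadProj_eq_self {τ : Trace A PComm Method} {t : ThreadID}
    (h : ∀ φ ∈ τ, φ.tid = t) : threadProj τ t = τ := by
  simpa [threadProj] using h

theorem threadProj_eq_nil {τ : Trace A PComm Method} {t : ThreadID}
    (h : ∀ φ ∈ τ, φ.tid ≠ t) : threadProj τ t = [] := by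
  simpa [threadProj] using h

theorem history_append (τ₁ τ₂ : Trace A PComm Method) :
    history (τ₁ ++ τ₂) = history τ₁ ++ history τ₂ :=
  List.filterMap_append ..

@[simp] theorem history_cons_iface (ψ : CallRetAct A Method) (τ : Trace A PComm Method) :
    history (.iface ψ :: τ) = ψ :: history τ := rfl

@[simp] theorem history_cons_prim (t : ThreadID) (c : PComm) (τ : Trace A PComm Method) :
    history (.prim t c :: τ) = history τ := rfl

@[simp] theorem history_nil : history ([] : Trace A PComm Method) = [] := rfl

/-- The threads inside a method after an action, where `M` describes those before it. -/
def nextInside (M : ThreadID → Bool) : Act A PComm Method → ThreadID → Bool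
  | .iface ψ => Function.update M ψ.tid ψ.isCall
  | .prim _ _ => M

/-- The threads inside a method after a trace, where `M` describes those before it. -/
def inside (M : ThreadID → Bool) (τ : Trace A PComm Method) : ThreadID → Bool :=
  τ.foldl nextInside M

theorem inside_append (M : ThreadID → Bool) (τ₁ τ₂ : Trace A PComm Method) :
    inside M (τ₁ ++ τ₂) = inside (inside M τ₁) τ₂ :=
  List.foldl_append

@[simp] theorem inside_nil (M : ThreadID → Bool) :
    inside M ([] : Trace A PComm Method) = M := rfl

@[simp] theorem inside_cons (M : ThreadID → Bool) (φ : Act A PComm Method)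
    (τ : Trace A PComm Method) : inside M (φ :: τ) = inside (nextInside M φ) τ := rfl

theorem nextInside_erase (M : ThreadID → Bool) (φ : Act A PComm Method) :
    nextInside M φ.erase = nextInside M φ := by
  cases φ <;> simp [nextInside, Act.erase]

theorem inside_map_erase (M : ThreadID → Bool) (τ : Trace A PComm Method) :
    inside M (τ.map Act.erase) = inside M τ := by
  induction τ generalizing M with
  | nil => rfl
  | cons φ τ ih => simp [ih, nextInside_erase]

/-- The interface actions together with the primitive actions performed inside methods
(for `keep = true`) or outside methods (for `keep = false`). -/
def part (keep : Bool) : (ThreadID → Bool) → Trace A PComm Method → Trace A PComm Method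
  | _, [] => []
  | M, .iface ψ :: τ => .iface ψ :: part keep (Function.update M ψ.tid ψ.isCall) τ
  | M, .prim t c :: τ => if M t = keep then .prim t c :: part keep M τ else part keep M τ

theorem part_append (keep : Bool) (M : ThreadID → Bool) (τ₁ τ₂ : Trace A PComm Method) :
    part keep M (τ₁ ++ τ₂) = part keep M τ₁ ++ part keep (inside M τ₁) τ₂ := by
  induction τ₁ generalizing M with
  | nil => rfl
  | cons φ τ₁ ih =>
    cases φ with
    | iface ψ => simp [part, ih, nextInside]
    | prim t c =>
      by_cases h : M t = keep <;> simp [part, ih, nextInside, h]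

theorem inside_part (keep : Bool) (M : ThreadID → Bool) (τ : Trace A PComm Method) :
    inside M (part keep M τ) = inside M τ := by
  induction τ generalizing M with
  | nil => rfl
  | cons φ τ ih =>
    cases φ with
    | iface ψ => simp [part, ih, nextInside]
    | prim t c => by_cases h : M t = keep <;> simp [part, ih, nextInside, h]

/-- `inside` for a single thread. -/
def insideThread (b : Bool) : Trace A PComm Method → Bool
  | [] => b
  | .iface ψ :: τ => insideThread ψ.isCall τ
  | .prim _ _ :: τ => insideThread b τ

/-- `part` for a single thread. -/
def partThread (keep : Bool) : Bool → Trace A PComm Method → Trace A PComm Method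
  | _, [] => []
  | _, .iface ψ :: τ => .iface ψ :: partThread keep ψ.isCall τ
  | b, .prim t c :: τ => if b = keep then .prim t c :: partThread keep b τ
      else partThread keep b τ

theorem inside_apply (M : ThreadID → Bool) (τ : Trace A PComm Method) (t : ThreadID) :
    inside M τ t = insideThread (M t) (threadProj τ t) := by
  induction τ generalizing M with
  | nil => rfl
  | cons φ τ ih =>
    by_cases h : φ.tid = t
    · rw [inside_cons, ih, threadProj_cons_of_eq h]
      cases φ with
      | iface ψ =>
        simp only [Act.tid] at h
        simp [nextInside, insideThread, ← h]
      | prim t c => rfl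
    · rw [inside_cons, ih, threadProj_cons_of_ne h]
      cases φ with
      | iface ψ =>
        simp only [Act.tid] at h
        simp [nextInside, Function.update_of_ne (Ne.symm h)]
      | prim t c => rfl

/-- Whether a thread is inside a method depends on its own actions alone, so taking a part commutes
with projecting to a thread. Trace sets of parallel programs are defined thread by thread, which
makes this the bridge to them. -/
theorem threadProj_part (keep : Bool) (M : ThreadID → Bool) (τ : Trace A PComm Method)
    (t : ThreadID) : threadProj (part keep M τ) t = partThread keep (M t) (threadProj τ t) := by
  induction τ generalizing M with
  | nil => rfl
  | cons φ τ ih =>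
    by_cases h : φ.tid = t
    · rw [threadProj_cons_of_eq h]
      cases φ with
      | iface ψ =>
        rw [part, threadProj_cons_of_eq h, ih, partThread]
        simp only [Act.tid] at h
        simp [← h]
      | prim u c =>
        simp only [Act.tid] at h
        subst h
        simp only [part, partThread]
        split_ifs
        · rw [threadProj_cons_of_eq (t := u) rfl, ih]
        · rw [ih]
    · rw [threadProj_cons_of_ne h]
      cases φ with
      | iface ψ =>
        rw [part, threadProj_cons_of_ne h, ih]
        simp only [Act.tid] at h
        rw [Function.update_of_ne (Ne.symm h)]
      | prim u c =>
        simp only [part]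
        split_ifs
        · rw [threadProj_cons_of_ne h, ih]
        · rw [ih]

theorem insideThread_append (b : Bool) (w₁ w₂ : Trace A PComm Method) :
    insideThread b (w₁ ++ w₂) = insideThread (insideThread b w₁) w₂ := by
  induction w₁ generalizing b with
  | nil => rfl
  | cons φ w₁ ih => cases φ <;> simp [insideThread, ih]

theorem partThread_append (keep b : Bool) (w₁ w₂ : Trace A PComm Method) :
    partThread keep b (w₁ ++ w₂) =
      partThread keep b w₁ ++ partThread keep (insideThread b w₁) w₂ := by
  induction w₁ generalizing b with
  | nil => rfl
  | cons φ w₁ ih =>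
    cases φ with
    | iface ψ => simp [partThread, insideThread, ih]
    | prim t c => by_cases h : b = keep <;> simp [partThread, insideThread, ih, h]

theorem partThread_prefix (keep b : Bool) {w₁ w₂ : Trace A PComm Method} (h : w₁ <+: w₂) :
    partThread keep b w₁ <+: partThread keep b w₂ := by
  obtain ⟨w, rfl⟩ := h
  rw [partThread_append]
  exact List.prefix_append ..

/-- Starting outside methods, the first action is kept whatever it is. -/
theorem partThread_false_eq_nil {w : Trace A PComm Method}
    (h : partThread false false w = []) : w = [] := by
  cases w with
  | nil => rfl
  | cons φ w => cases φ <;> simp [partThread] at h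

/-- Calls and returns of every thread alternate, and primitive actions are performed only
inside methods. -/
def Alternates : (ThreadID → Bool) → Trace A PComm Method → Prop
  | _, [] => True
  | M, .iface ψ :: τ => ψ.isCall = !M ψ.tid ∧
      Alternates (Function.update M ψ.tid ψ.isCall) τ
  | M, .prim t _ :: τ => M t = true ∧ Alternates M τ

/-- `Alternates` for a single thread. -/
def AlternatesThread : Bool → Trace A PComm Method → Prop
  | _, [] => True
  | b, .iface ψ :: τ => ψ.isCall = !b ∧ AlternatesThread ψ.isCall τ
  | b, .prim _ _ :: τ => b = true ∧ AlternatesThread b τ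

theorem alternates_of_threads {M : ThreadID → Bool} {τ : Trace A PComm Method}
    (h : ∀ t, AlternatesThread (M t) (threadProj τ t)) : Alternates M τ := by
  induction τ generalizing M with
  | nil => trivial
  | cons φ τ ih =>
    have h₁ := h φ.tid
    rw [threadProj_cons_of_eq rfl] at h₁
    cases φ with
    | iface ψ =>
      refine ⟨h₁.1, ih fun t => ?_⟩
      by_cases ht : ψ.tid = t
      · subst ht
        rw [Function.update_self]
        exact h₁.2
      · rw [Function.update_of_ne (Ne.symm ht)]
        have := h t
        rwa [threadProj_cons_of_ne (by exact ht)] at this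
    | prim u c =>
      refine ⟨h₁.1, ih fun t => ?_⟩
      by_cases ht : u = t
      · subst ht
        exact h₁.2
      · have := h t
        rwa [threadProj_cons_of_ne (by exact ht)] at this

theorem alternates_append {M : ThreadID → Bool} {τ₁ τ₂ : Trace A PComm Method} :
    Alternates M (τ₁ ++ τ₂) ↔ Alternates M τ₁ ∧ Alternates (inside M τ₁) τ₂ := by
  induction τ₁ generalizing M with
  | nil => simp [Alternates]
  | cons φ τ₁ ih => cases φ <;> simp [Alternates, nextInside, ih, and_assoc]

theorem alternates_map_erase {M : ThreadID → Bool} {τ : Trace A PComm Method} :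
    Alternates M (τ.map Act.erase) ↔ Alternates M τ := by
  induction τ generalizing M with
  | nil => simp [Alternates]
  | cons φ τ ih => cases φ <;> simp [Alternates, Act.erase, ih]

theorem alternatesThread_append {b : Bool} {w₁ w₂ : Trace A PComm Method} :
    AlternatesThread b (w₁ ++ w₂) ↔
      AlternatesThread b w₁ ∧ AlternatesThread (insideThread b w₁) w₂ := by
  induction w₁ generalizing b with
  | nil => simp [AlternatesThread, insideThread]
  | cons φ w₁ ih => cases φ <;> simp [AlternatesThread, insideThread, ih, and_assoc]

theorem not_inMethod_nil (t : ThreadID) : ¬ InMethod ([] : Trace A PComm Method) t := by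
  rintro ⟨π₁, π₂, m, a, h, -⟩
  simp at h

theorem inMethod_snoc {π : Trace A PComm Method} {φ : Act A PComm Method} {t : ThreadID} :
    InMethod (π ++ [φ]) t ↔ (∃ m a, φ = .iface (.call t m a)) ∨
      (InMethod π t ∧ ∀ m a, φ ≠ .iface (.ret t m a)) := by
  constructor
  · rintro ⟨π₁, π₂, m, a, h, hr⟩
    rcases List.eq_nil_or_concat π₂ with rfl | ⟨π₂, φ', rfl⟩
    · left
      have := List.append_inj_right' h rfl
      exact ⟨m, a, by simpa using this⟩
    · right
      rw [List.concat_eq_append, ← List.cons_append, ← List.append_assoc] at h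
      obtain ⟨h₁, h₂⟩ := List.append_inj' h rfl
      simp only [List.cons.injEq, and_true] at h₂
      subst h₂
      simp only [List.concat_eq_append, List.mem_append, List.mem_singleton, not_or] at hr
      exact ⟨⟨π₁, π₂, m, a, h₁, fun m' a' => (hr m' a').1⟩, fun m' a' h => (hr m' a').2 h.symm⟩
  · rintro (⟨m, a, rfl⟩ | ⟨⟨π₁, π₂, m, a, rfl, hr⟩, hφ⟩)
    · exact ⟨π, [], m, a, rfl, by simp⟩
    · refine ⟨π₁, π₂ ++ [φ], m, a, by simp, fun m' a' => ?_⟩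
      simp only [List.mem_append, List.mem_singleton, not_or]
      exact ⟨hr m' a', fun h => hφ m' a' h.symm⟩

/-- Both sides say that `π` has an interface action by `t` and that the last one is a call. -/
theorem inMethod_iff_inside (π : Trace A PComm Method) (t : ThreadID) :
    InMethod π t ↔ inside (fun _ => false) π t = true := by
  induction π using List.reverseRecOn with
  | nil => simp [not_inMethod_nil]
  | append_singleton π φ ih =>
    rw [inMethod_snoc, inside_append, inside_cons, inside_nil, ih]
    rcases φ with ((⟨u, m, a⟩ | ⟨u, m, a⟩) | ⟨u, c⟩)
    · by_cases h : t = u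
      · subst h
        simp [nextInside, CallRetAct.tid, CallRetAct.isCall]
      · simp [nextInside, CallRetAct.tid, CallRetAct.isCall, h, Ne.symm h]
    · by_cases h : t = u
      · subst h
        simp [nextInside, CallRetAct.tid, CallRetAct.isCall]
      · simp [nextInside, CallRetAct.tid, CallRetAct.isCall, h, Ne.symm h]
    · simp [nextInside]

theorem clientAfter_eq_part (π τ : Trace A PComm Method) :
    clientAfter π τ = part false (inside (fun _ => false) π) τ := by
  induction τ generalizing π with
  | nil => rfl
  | cons φ τ ih =>
    cases φ with
    | iface ψ => simp [clientAfter, part, ih, inside_append, nextInside]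
    | prim t c =>
      simp only [clientAfter, part, ih, inside_append, inside_cons, inside_nil, nextInside,
        inMethod_iff_inside]
      cases inside (fun _ => false) π t <;> simp

theorem client_eq_part (τ : Trace A PComm Method) :
    client τ = part false (fun _ => false) τ :=
  clientAfter_eq_part [] τ

end Projections

/-! ### Trace sets: interleavings, filling in method bodies, the most general client -/

section TraceSets

theorem starSet_nil {α : Type*} (T : Set (List α)) : [] ∈ starSet T :=
  ⟨[], by simp⟩

theorem starSet_append {α : Type*} {T : Set (List α)} {x y : List α} (hx : x ∈ T)
    (hy : y ∈ starSet T) : x ++ y ∈ starSet T := by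
  obtain ⟨ts, h, rfl⟩ := hy
  exact ⟨x :: ts, by simpa using ⟨hx, h⟩, rfl⟩

theorem starSet_induction {α : Type*} {T : Set (List α)} {P : List α → Prop} (nil : P [])
    (append : ∀ x ∈ T, ∀ y ∈ starSet T, P y → P (x ++ y)) : ∀ z ∈ starSet T, P z := by
  rintro _ ⟨ts, h, rfl⟩
  induction ts with
  | nil => exact nil
  | cons x ts ih =>
    have h' : ∀ y ∈ ts, y ∈ T := fun y hy => h y (List.mem_cons_of_mem _ hy)
    exact append x (h x List.mem_cons_self) _ ⟨ts, h', rfl⟩ (ih h')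

theorem subset_prefixClosure {α : Type*} {T : Set (List α)} {x : List α} (h : x ∈ T) :
    x ∈ prefixClosure T :=
  ⟨x, h, List.prefix_refl x⟩

theorem prefixClosure_of_prefix {α : Type*} {T : Set (List α)} {x y : List α}
    (h : y ∈ prefixClosure T) (hxy : x <+: y) : x ∈ prefixClosure T := by
  obtain ⟨z, hz, hyz⟩ := h
  exact ⟨z, hz, hxy.trans hyz⟩

variable {PComm Method : Type*}

theorem threadProj_flatMap_range {r : ThreadID → Trace Unit PComm Method}
    (hr : ∀ t, ∀ φ ∈ r t, φ.tid = t) (n : ℕ) (t : ThreadID) :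
    threadProj ((List.range n).flatMap r) t = if t < n then r t else [] := by
  induction n with
  | zero => simp [threadProj]
  | succ n ih =>
    rw [List.range_succ, List.flatMap_append, threadProj_append, ih]
    simp only [List.flatMap_cons, List.flatMap_nil, List.append_nil]
    rcases lt_trichotomy t n with h | h | h
    · rw [threadProj_eq_nil fun φ hφ => (hr n φ hφ).trans_ne h.ne', if_pos h,
        if_pos (Nat.lt_succ_of_lt h), List.append_nil]
    · subst h
      rw [threadProj_eq_self (hr t)]
      simp
    · rw [threadProj_eq_nil fun φ hφ => (hr n φ hφ).trans_ne h.ne, if_neg h.not_gt,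
        if_neg (Nat.not_lt.2 h), List.append_nil]

/-- For the converse, each thread's prefix has a completing remainder. Appending these remainders
one thread after another is a legitimate interleaving, since each consists of actions of its own
thread. -/
theorem mem_prefixClosure_parTraces {n : ℕ} {T : ThreadID → Set (Trace Unit PComm Method)}
    (hT : ∀ t, ∀ w ∈ T t, ∀ φ ∈ w, φ.tid = t) {τ : Trace Unit PComm Method} :
    τ ∈ prefixClosure (parTraces n T) ↔
      (∀ φ ∈ τ, φ.tid < n) ∧ ∀ t < n, threadProj τ t ∈ prefixClosure (T t) := by
  constructor
  · rintro ⟨_, ⟨h₁, h₂⟩, r, rfl⟩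
    refine ⟨fun φ hφ => h₁ φ (List.mem_append_left _ hφ), fun t ht => ?_⟩
    exact ⟨_, h₂ t ht, by rw [threadProj_append]; exact List.prefix_append ..⟩
  · rintro ⟨h₁, h₂⟩
    have h₃ : ∀ t, ∃ r, (∀ φ ∈ r, φ.tid = t) ∧ (t < n → threadProj τ t ++ r ∈ T t) := by
      intro t
      by_cases ht : t < n
      · obtain ⟨_, hw, r, rfl⟩ := h₂ t ht
        exact ⟨r, fun φ hφ => hT t _ hw φ (List.mem_append_right _ hφ), fun _ => hw⟩
      · exact ⟨[], by simp, fun h => absurd h ht⟩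
    choose r hr hrT using h₃
    refine ⟨τ ++ (List.range n).flatMap r, ⟨fun φ hφ => ?_, fun t ht => ?_⟩,
      List.prefix_append ..⟩
    · rcases List.mem_append.1 hφ with hφ | hφ
      · exact h₁ φ hφ
      · obtain ⟨t, ht, hφ⟩ := List.mem_flatMap.1 hφ
        rw [hr t φ hφ]
        exact List.mem_range.1 ht
    · rw [threadProj_append, threadProj_flatMap_range hr, if_pos ht]
      exact hrT t ht

/-- All traces in `η m t` consist of primitive actions by `t`. -/
def PrimitiveBodies (η : Method → ThreadID → Set (Trace Unit PComm Method)) : Prop :=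
  ∀ m t, ∀ b ∈ η m t, ∀ φ ∈ b, ∃ c, φ = .prim t c

theorem Cmd.traces_primitive {η : Method → ThreadID → Set (Trace Unit PComm Method)}
    {t : ThreadID} : ∀ {C : Cmd PComm Method}, C.methods = ∅ →
      ∀ b ∈ C.traces η t, ∀ φ ∈ b, ∃ c, φ = .prim t c := by
  intro C
  induction C with
  | prim c =>
    rintro - b rfl φ hφ
    exact ⟨c, by simpa using hφ⟩
  | call m => exact fun h => absurd h (Set.singleton_ne_empty m)
  | seq C₁ C₂ ih₁ ih₂ =>
    rintro h _ ⟨b₁, h₁, b₂, h₂, rfl⟩ φ hφ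
    obtain ⟨hm₁, hm₂⟩ := Set.union_empty_iff.1 h
    rcases List.mem_append.1 hφ with hφ | hφ
    · exact ih₁ hm₁ b₁ h₁ φ hφ
    · exact ih₂ hm₂ b₂ h₂ φ hφ
  | choice C₁ C₂ ih₁ ih₂ =>
    obtain h := Set.union_empty_iff (s := C₁.methods) (t := C₂.methods)
    rintro hm b (hb | hb)
    · exact ih₁ (h.1 hm).1 b hb
    · exact ih₂ (h.1 hm).2 b hb
  | star C ih =>
    intro h
    refine starSet_induction (by simp) fun x hx y _ hy φ hφ => ?_
    rcases List.mem_append.1 hφ with hφ | hφ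
    · exact ih h x hx φ hφ
    · exact hy φ hφ

/-- Used to complete calls: a method body always has some trace, so a call that has just started can
be extended to a full call. -/
theorem Cmd.traces_nonempty {η : Method → ThreadID → Set (Trace Unit PComm Method)}
    {t : ThreadID} : ∀ {C : Cmd PComm Method}, C.methods = ∅ → (C.traces η t).Nonempty := by
  intro C
  induction C with
  | prim c => exact fun _ => ⟨_, rfl⟩
  | call m => exact fun h => absurd h (Set.singleton_ne_empty m)
  | seq C₁ C₂ ih₁ ih₂ =>
    intro h
    obtain ⟨hm₁, hm₂⟩ := Set.union_empty_iff.1 h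
    obtain ⟨b₁, h₁⟩ := ih₁ hm₁
    obtain ⟨b₂, h₂⟩ := ih₂ hm₂
    exact ⟨b₁ ++ b₂, b₁, h₁, b₂, h₂, rfl⟩
  | choice C₁ C₂ ih₁ ih₂ =>
    intro h
    obtain ⟨b₁, h₁⟩ := ih₁ (Set.union_empty_iff.1 h).1
    exact ⟨b₁, Or.inl h₁⟩
  | star C ih => exact fun _ => ⟨[], starSet_nil _⟩

theorem LibraryHasSpec.primitiveBodies {S : Type*} {L : Library PComm Method}
    {Γ : Spec S Method} (h : LibraryHasSpec L Γ) : PrimitiveBodies (Library.bodyTraces L) := by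
  rintro m t b ⟨C, hC, hb⟩
  exact Cmd.traces_primitive (h.2 m C hC) b hb

theorem LibraryHasSpec.bodyTraces_nonempty {S : Type*} {L : Library PComm Method}
    {Γ : Spec S Method} (h : LibraryHasSpec L Γ) {m : Method} (hm : (Γ m).isSome)
    (t : ThreadID) : (Library.bodyTraces L m t).Nonempty := by
  obtain ⟨C, hC⟩ := Option.isSome_iff_exists.1 ((h.1 m).2 hm)
  obtain ⟨b, hb⟩ := Cmd.traces_nonempty (η := fun _ _ => ∅) (t := t) (h.2 m C hC)
  exact ⟨b, C, hC, hb⟩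

/-- The trace `w` is obtained from `u`, in which all method bodies are empty, by filling in
method bodies from `η`. -/
inductive Fills (η : Method → ThreadID → Set (Trace Unit PComm Method)) (t : ThreadID) :
    Trace Unit PComm Method → Trace Unit PComm Method → Prop
  | nil : Fills η t [] []
  | prim (c : PComm) {u w : Trace Unit PComm Method} : Fills η t u w →
      Fills η t (.prim t c :: u) (.prim t c :: w)
  | call (m : Method) {b u w : Trace Unit PComm Method} : b ∈ η m t → Fills η t u w →
      Fills η t (.iface (.call t m ()) :: .iface (.ret t m ()) :: u)
        (.iface (.call t m ()) :: (b ++ .iface (.ret t m ()) :: w))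

/-- The trace sets of empty method bodies. -/
abbrev emptyBodies : Method → ThreadID → Set (Trace Unit PComm Method) := fun _ _ => {[]}

variable {η : Method → ThreadID → Set (Trace Unit PComm Method)} {t : ThreadID}

theorem Fills.append {u₁ w₁ u₂ w₂ : Trace Unit PComm Method} (h₁ : Fills η t u₁ w₁)
    (h₂ : Fills η t u₂ w₂) : Fills η t (u₁ ++ u₂) (w₁ ++ w₂) := by
  induction h₁ with
  | nil => exact h₂
  | prim c _ ih => exact .prim c ih
  | call m hb _ ih =>
    have := Fills.call m hb ih
    simpa using this

theorem Fills.eq_of_emptyBodies {u w : Trace Unit PComm Method} (h : Fills emptyBodies t u w) :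
    w = u := by
  induction h with
  | nil => rfl
  | prim c _ ih => rw [ih]
  | call m hb _ ih => rw [ih, Set.mem_singleton_iff.1 hb, List.nil_append]

/-- The role of `h₁` is to say that `u₁` is well formed: it does not break off between a call and
its return, so the filling can be cut at the same place. -/
theorem Fills.split {u₁ u₂ v w : Trace Unit PComm Method} (h₁ : Fills emptyBodies t u₁ v)
    (h : Fills η t (u₁ ++ u₂) w) :
    ∃ w₁ w₂, w = w₁ ++ w₂ ∧ Fills η t u₁ w₁ ∧ Fills η t u₂ w₂ := by
  induction h₁ generalizing w with
  | nil => exact ⟨[], w, rfl, .nil, h⟩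
  | prim c _ ih =>
    cases h with
    | prim _ h =>
      obtain ⟨w₁, w₂, rfl, hw₁, hw₂⟩ := ih h
      exact ⟨_, w₂, rfl, .prim c hw₁, hw₂⟩
  | call m _ _ ih =>
    cases h with
    | call _ hb h =>
      obtain ⟨w₁, w₂, rfl, hw₁, hw₂⟩ := ih h
      exact ⟨_, w₂, by simp, .call m hb hw₁, hw₂⟩

/-- Together with `Cmd.mem_traces_of_fills`, this describes the traces of a command with bodies `η`
as the fillings of its traces with empty bodies, which separates the control flow of the client from
the choice of bodies. -/
theorem Cmd.exists_fills {C : Cmd PComm Method} : ∀ {w : Trace Unit PComm Method},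
    w ∈ C.traces η t → ∃ u ∈ C.traces emptyBodies t, Fills η t u w := by
  induction C with
  | prim c =>
    rintro _ rfl
    exact ⟨_, rfl, .prim c .nil⟩
  | call m =>
    rintro _ ⟨b, hb, rfl⟩
    exact ⟨_, ⟨[], rfl, rfl⟩, .call m hb .nil⟩
  | seq C₁ C₂ ih₁ ih₂ =>
    rintro _ ⟨w₁, h₁, w₂, h₂, rfl⟩
    obtain ⟨u₁, hu₁, hf₁⟩ := ih₁ h₁
    obtain ⟨u₂, hu₂, hf₂⟩ := ih₂ h₂
    exact ⟨_, ⟨u₁, hu₁, u₂, hu₂, rfl⟩, hf₁.append hf₂⟩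
  | choice C₁ C₂ ih₁ ih₂ =>
    rintro w (h | h)
    · obtain ⟨u, hu, hf⟩ := ih₁ h
      exact ⟨u, Or.inl hu, hf⟩
    · obtain ⟨u, hu, hf⟩ := ih₂ h
      exact ⟨u, Or.inr hu, hf⟩
  | star C ih =>
    intro w hw
    refine starSet_induction (P := fun w => ∃ u ∈ starSet (C.traces emptyBodies t),
      Fills η t u w) ⟨[], starSet_nil _, .nil⟩ ?_ w hw
    rintro x hx y - ⟨u₂, hu₂, hf₂⟩
    obtain ⟨u₁, hu₁, hf₁⟩ := ih hx
    exact ⟨_, starSet_append hu₁ hu₂, hf₁.append hf₂⟩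

theorem Cmd.fills_self {C : Cmd PComm Method} {u : Trace Unit PComm Method}
    (h : u ∈ C.traces emptyBodies t) : Fills emptyBodies t u u := by
  obtain ⟨u', -, hf⟩ := Cmd.exists_fills h
  obtain rfl := hf.eq_of_emptyBodies
  exact hf

theorem Cmd.mem_traces_of_fills {C : Cmd PComm Method} : ∀ {u w : Trace Unit PComm Method},
    u ∈ C.traces emptyBodies t → Fills η t u w → w ∈ C.traces η t := by
  induction C with
  | prim c =>
    rintro _ w rfl h
    cases h with
    | prim _ h => cases h; rfl
  | call m =>
    rintro _ w ⟨b, hb, rfl⟩ h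
    obtain rfl := Set.mem_singleton_iff.1 hb
    cases h with
    | call _ hb h => cases h; exact ⟨_, hb, rfl⟩
  | seq C₁ C₂ ih₁ ih₂ =>
    rintro _ w ⟨u₁, h₁, u₂, h₂, rfl⟩ h
    obtain ⟨w₁, w₂, rfl, hf₁, hf₂⟩ := Fills.split (Cmd.fills_self h₁) h
    exact ⟨w₁, ih₁ h₁ hf₁, w₂, ih₂ h₂ hf₂, rfl⟩
  | choice C₁ C₂ ih₁ ih₂ =>
    rintro u w (hu | hu) h
    · exact Or.inl (ih₁ hu h)
    · exact Or.inr (ih₂ hu h)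
  | star C ih =>
    intro u w hu
    refine starSet_induction (P := fun u => ∀ w, Fills η t u w → w ∈ starSet (C.traces η t))
      ?_ ?_ u hu w
    · intro w h
      cases h
      exact starSet_nil _
    · intro x hx y _ hy w h
      obtain ⟨w₁, w₂, rfl, hf₁, hf₂⟩ := Fills.split (Cmd.fills_self hx) h
      exact starSet_append (ih hx hf₁) (hy w₂ hf₂)

theorem Fills.tid_eq (hη : PrimitiveBodies η) {u w : Trace Unit PComm Method}
    (h : Fills η t u w) : ∀ φ ∈ w, φ.tid = t := by
  induction h with
  | nil => simp
  | prim c _ ih => simpa [Act.tid] using ih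
  | call m hb _ ih =>
    intro φ hφ
    simp only [List.mem_cons, List.mem_append] at hφ
    rcases hφ with rfl | hφ | rfl | hφ
    · rfl
    · obtain ⟨c, rfl⟩ := hη m t _ hb φ hφ
      rfl
    · rfl
    · exact ih φ hφ

theorem primitiveBodies_emptyBodies :
    PrimitiveBodies (emptyBodies (PComm := PComm) (Method := Method)) := by
  rintro m t b rfl
  simp

theorem partThread_false_of_primitive {b w : Trace Unit PComm Method}
    (hb : ∀ φ ∈ b, ∃ c, φ = Act.prim t c) :
    partThread false true (b ++ w) = partThread false true w := by
  induction b with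
  | nil => rfl
  | cons φ b ih =>
    obtain ⟨c, rfl⟩ := hb φ List.mem_cons_self
    simpa [partThread] using ih fun φ hφ => hb φ (List.mem_cons_of_mem _ hφ)

theorem partThread_true_of_primitive {b w : Trace Unit PComm Method}
    (hb : ∀ φ ∈ b, ∃ c, φ = Act.prim t c) :
    partThread true true (b ++ w) = b ++ partThread true true w := by
  induction b with
  | nil => rfl
  | cons φ b ih =>
    obtain ⟨c, rfl⟩ := hb φ List.mem_cons_self
    simpa [partThread] using ih fun φ hφ => hb φ (List.mem_cons_of_mem _ hφ)

theorem insideThread_of_primitive {b : Trace Unit PComm Method}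
    (hb : ∀ φ ∈ b, ∃ c, φ = Act.prim t c) (x : Bool) : insideThread x b = x := by
  induction b with
  | nil => rfl
  | cons φ b ih =>
    obtain ⟨c, rfl⟩ := hb φ List.mem_cons_self
    exact ih fun φ hφ => hb φ (List.mem_cons_of_mem _ hφ)

theorem alternatesThread_of_primitive {b : Trace Unit PComm Method}
    (hb : ∀ φ ∈ b, ∃ c, φ = Act.prim t c) : AlternatesThread true b := by
  induction b with
  | nil => trivial
  | cons φ b ih =>
    obtain ⟨c, rfl⟩ := hb φ List.mem_cons_self
    exact ⟨rfl, ih fun φ hφ => hb φ (List.mem_cons_of_mem _ hφ)⟩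

theorem Fills.partThread_false (hη : PrimitiveBodies η) {u w : Trace Unit PComm Method}
    (h : Fills η t u w) : partThread false false w = u := by
  induction h with
  | nil => rfl
  | prim c _ ih => simp [partThread, ih]
  | call m hb _ ih =>
    simp only [partThread, CallRetAct.isCall, partThread_false_of_primitive (hη m t _ hb), ih]

/-- Dropping the client commands leaves a sequence of complete calls, which is what a thread of the
most general client performs. -/
theorem Fills.partThread_true {L : Library PComm Method}
    (hη : PrimitiveBodies (Library.bodyTraces L)) {u w : Trace Unit PComm Method}
    (h : Fills (Library.bodyTraces L) t u w) :
    partThread true false w ∈ mgcTraces L t := by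
  induction h with
  | nil => exact starSet_nil _
  | prim c _ ih => simpa [partThread] using ih
  | @call m b u w hb _ ih =>
    simp only [partThread, CallRetAct.isCall, partThread_true_of_primitive (hη m t _ hb)]
    obtain ⟨C, hC, -⟩ := id hb
    have := starSet_append (T := {τ | ∃ m, (L m).isSome ∧ τ ∈ callTraces t m
      (Library.bodyTraces L m t)}) ⟨m, by simp [hC], b, hb, rfl⟩ ih
    simpa [mgcTraces] using this

theorem mgcTraces_tid {L : Library PComm Method} (hL : PrimitiveBodies (Library.bodyTraces L)) :
    ∀ t, ∀ w ∈ mgcTraces L t, ∀ φ ∈ w, φ.tid = t := by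
  intro t
  refine starSet_induction (by simp) ?_
  rintro _ ⟨m, -, b, hb, rfl⟩ y - hy φ hφ
  simp only [List.mem_cons, List.mem_append, List.cons_append, List.append_assoc, List.nil_append] at hφ
  rcases hφ with rfl | hφ | rfl | hφ
  · rfl
  · obtain ⟨c, rfl⟩ := hL m t b hb φ hφ
    rfl
  · rfl
  · exact hy φ hφ

theorem mgcTraces_alternates {L : Library PComm Method}
    (hL : PrimitiveBodies (Library.bodyTraces L)) {w : Trace Unit PComm Method}
    (hw : w ∈ prefixClosure (mgcTraces L t)) : AlternatesThread false w := by
  obtain ⟨w', hw', r, rfl⟩ := hw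
  refine (alternatesThread_append.1 (?_ : AlternatesThread false (w ++ r))).1
  refine starSet_induction (P := AlternatesThread false) trivial ?_ _ hw'
  rintro _ ⟨m, -, b, hb, rfl⟩ y - hy
  have hb' := hL m t b hb
  simpa [AlternatesThread, CallRetAct.isCall, alternatesThread_append,
    insideThread_of_primitive hb', alternatesThread_of_primitive hb'] using hy

/-- A thread of the most general client that is not inside a method may call any method. -/
theorem mgcTraces_call {L : Library PComm Method} (hL : PrimitiveBodies (Library.bodyTraces L))
    {m : Method} (hm : (L m).isSome) (hb : (Library.bodyTraces L m t).Nonempty)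
    {w : Trace Unit PComm Method} (hw : w ∈ prefixClosure (mgcTraces L t))
    (hi : insideThread false w = false) :
    w ++ [.iface (.call t m ())] ∈ prefixClosure (mgcTraces L t) := by
  obtain ⟨w', hw', h⟩ := hw
  have hnil : [Act.iface (.call t m ())] ∈ prefixClosure (mgcTraces L t) := by
    obtain ⟨b, hb⟩ := hb
    exact ⟨_, starSet_append ⟨m, hm, b, hb, rfl⟩ (starSet_nil _), by simp⟩
  revert w
  refine starSet_induction (P := fun w' => ∀ {w : Trace Unit PComm Method},
    insideThread false w = false → w <+: w' →
      w ++ [.iface (.call t m ())] ∈ prefixClosure (mgcTraces L t)) ?_ ?_ w' hw'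
  · intro w _ h
    obtain rfl := List.prefix_nil.1 h
    exact hnil
  · rintro x ⟨m', hm', b', hb', rfl⟩ y - ih w hi hw
    have hb'' := hL m' t b' hb'
    have hlong : ∀ v, v <+: y → w = .iface (.call t m' ()) :: (b' ++ [.iface (.ret t m' ())]) ++ v →
        w ++ [.iface (.call t m ())] ∈ prefixClosure (mgcTraces L t) := by
      rintro v hv rfl
      obtain ⟨z, hz, r, rfl⟩ := ih (w := v) (by
        simpa [insideThread, insideThread_append, insideThread_of_primitive hb'',
          CallRetAct.isCall] using hi) hv
      exact ⟨_, starSet_append ⟨m', hm', b', hb', rfl⟩ hz, r, by simp⟩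
    -- Either `w` ends within the first call, or it continues into `y`. In the former case it is
    -- empty, stops strictly inside the method, which `hi` forbids, or is the complete call, which
    -- is treated as the latter case with nothing of `y` consumed.
    rcases List.prefix_or_prefix_of_prefix hw (List.prefix_append _ y) with h | ⟨v, rfl⟩
    · rcases List.prefix_cons_iff.1 h with rfl | ⟨w₁, rfl, h₁⟩
      · exact hnil
      · rcases List.prefix_concat_iff.1 h₁ with rfl | ⟨r, rfl⟩
        · exact hlong [] (List.nil_prefix) (by simp)
        · rw [insideThread, insideThread_of_primitive fun φ hφ =>
            hb'' φ (List.mem_append_left _ hφ)] at hi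
          cases hi
    · exact hlong v ((List.prefix_append_right_inj _).1 hw) rfl

end TraceSets

/-! ### A trace of the program is determined by its client and library parts -/

section Parts

variable {S PComm Method : Type*} {t : ThreadID}

theorem starSet_eq_nil_or_append {α : Type*} {T : Set (List α)} {z : List α}
    (hz : z ∈ starSet T) : z = [] ∨ ∃ x ∈ T, ∃ y ∈ starSet T, z = x ++ y := by
  refine starSet_induction (P := fun z => z = [] ∨ ∃ x ∈ T, ∃ y ∈ starSet T, z = x ++ y)
    (Or.inl rfl) ?_ z hz
  exact fun x hx y hy _ => Or.inr ⟨x, hx, y, hy, rfl⟩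

theorem Cmd.mem_methods_of_call {C : Cmd PComm Method} {m : Method} :
    ∀ {u : Trace Unit PComm Method}, u ∈ C.traces emptyBodies t →
      .iface (.call t m ()) ∈ u → m ∈ C.methods := by
  induction C with
  | prim c =>
    rintro _ rfl h
    simp at h
  | call m' =>
    rintro _ ⟨b, rfl, rfl⟩ h
    simpa [Cmd.methods] using h
  | seq C₁ C₂ ih₁ ih₂ =>
    rintro _ ⟨u₁, h₁, u₂, h₂, rfl⟩ h
    rcases List.mem_append.1 h with h | h
    · exact Or.inl (ih₁ h₁ h)
    · exact Or.inr (ih₂ h₂ h)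
  | choice C₁ C₂ ih₁ ih₂ =>
    rintro u (hu | hu) h
    · exact Or.inl (ih₁ hu h)
    · exact Or.inr (ih₂ hu h)
  | star C ih =>
    intro u hu
    refine starSet_induction (P := fun u => .iface (.call t m ()) ∈ u → m ∈ C.methods)
      (by simp) ?_ u hu
    intro x hx y _ hy h
    rcases List.mem_append.1 h with h | h
    · exact ih hx h
    · exact hy h

theorem Fills.exists_of_nonempty {η : Method → ThreadID → Set (Trace Unit PComm Method)}
    {u v : Trace Unit PComm Method} (hu : Fills emptyBodies t u v)
    (hne : ∀ m, .iface (.call t m ()) ∈ u → (η m t).Nonempty) : ∃ w, Fills η t u w := by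
  induction hu with
  | nil => exact ⟨_, .nil⟩
  | prim c _ ih =>
    obtain ⟨w, hw⟩ := ih fun m hm => hne m (List.mem_cons_of_mem _ hm)
    exact ⟨_, .prim c hw⟩
  | call m _ _ ih =>
    obtain ⟨w, hw⟩ := ih fun m hm => hne m (by simp [hm])
    obtain ⟨b, hb⟩ := hne m List.mem_cons_self
    exact ⟨_, .call m hb hw⟩

/-- The trace `w` continues a thread inside a method. Its client part says that the next interface
action is the return, its library part that the commands before it follow `b`; so `w` stops within
`b` or has completed `b` and returned. -/
theorem body_prefix_cases {m : Method} {b : Trace Unit PComm Method}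
    (hb : ∀ φ ∈ b, ∃ c, φ = Act.prim t c) {w u y : Trace Unit PComm Method}
    (h₁ : partThread false true w <+: .iface (.ret t m ()) :: u)
    (h₂ : partThread true true w <+: b ++ .iface (.ret t m ()) :: y) :
    (∃ r, w ++ r = b) ∨ ∃ w', w = b ++ .iface (.ret t m ()) :: w' ∧
      partThread false false w' <+: u ∧ partThread true false w' <+: y := by
  induction b generalizing w with
  | nil =>
    rcases w with _ | ⟨ψ | ⟨t', c'⟩, w⟩
    · exact Or.inl ⟨[], rfl⟩
    · simp only [partThread, List.nil_append, List.cons_prefix_cons, Act.iface.injEq] at h₁ h₂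
      obtain ⟨rfl, h₁⟩ := h₁
      exact Or.inr ⟨w, rfl, h₁, h₂.2⟩
    · simp [partThread] at h₂
  | cons φ b ih =>
    obtain ⟨c, rfl⟩ := hb φ List.mem_cons_self
    rcases w with _ | ⟨ψ | ⟨t', c'⟩, w⟩
    · exact Or.inl ⟨_, rfl⟩
    · simp [partThread] at h₂
    · simp only [partThread, if_true, List.cons_append, List.cons_prefix_cons, Bool.true_eq_false,
        if_false] at h₁ h₂
      obtain ⟨he, h₂⟩ := h₂
      rw [he]
      rcases ih (fun φ hφ => hb φ (List.mem_cons_of_mem _ hφ)) h₁ h₂ with ⟨r, rfl⟩ | ⟨w', rfl, h⟩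
      · exact Or.inl ⟨r, rfl⟩
      · exact Or.inr ⟨w', rfl, h⟩

/-- A trace whose client part and library part can be continued can itself be continued. -/
theorem Fills.extend {L : Library PComm Method} (hL : PrimitiveBodies (Library.bodyTraces L))
    {u v w : Trace Unit PComm Method} (hu : Fills emptyBodies t u v)
    (hne : ∀ m, .iface (.call t m ()) ∈ u → (Library.bodyTraces L m t).Nonempty)
    (h₁ : partThread false false w <+: u)
    (h₂ : partThread true false w ∈ prefixClosure (mgcTraces L t)) :
    ∃ w', Fills (Library.bodyTraces L) t u (w ++ w') := by
  rcases eq_or_ne w [] with rfl | hw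
  · exact hu.exists_of_nonempty hne
  induction hu generalizing w with
  | nil => exact absurd (partThread_false_eq_nil (List.prefix_nil.1 h₁)) hw
  | prim c hu ih =>
    have hne' := fun m hm => hne m (List.mem_cons_of_mem _ hm)
    rcases w with _ | ⟨ψ | ⟨t', c'⟩, w⟩
    · exact absurd rfl hw
    · simp [partThread] at h₁
    · simp only [partThread, if_true, List.cons_prefix_cons, Bool.false_eq_true, if_false] at h₁ h₂
      obtain ⟨he, h₁⟩ := h₁
      rw [he]
      rcases eq_or_ne w [] with rfl | hw
      · obtain ⟨w', hw'⟩ := hu.exists_of_nonempty hne'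
        exact ⟨w', .prim c hw'⟩
      · obtain ⟨w', hw'⟩ := ih hne' h₁ h₂ hw
        exact ⟨w', .prim c hw'⟩
  | call m _ hu ih =>
    have hne' := fun m hm => hne m (List.mem_cons_of_mem _ (List.mem_cons_of_mem _ hm))
    rcases w with _ | ⟨ψ | ⟨t', c'⟩, w⟩
    · exact absurd rfl hw
    · simp only [partThread, List.cons_prefix_cons, Act.iface.injEq] at h₁ h₂
      obtain ⟨rfl, h₁⟩ := h₁
      obtain ⟨z, hz, h₂⟩ := h₂
      -- The library part decides the body: the first block of the most general client's trace `z`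
      -- supplies the `b` with which the call is filled.
      rcases starSet_eq_nil_or_append hz with rfl | ⟨_, ⟨m', -, b, hb, rfl⟩, y, hy, rfl⟩
      · simp at h₂
      simp only [List.cons_append, List.append_assoc, List.nil_append, List.cons_prefix_cons,
        Act.iface.injEq, CallRetAct.call.injEq, true_and, and_true, CallRetAct.isCall] at h₁ h₂
      obtain ⟨rfl, h₂⟩ := h₂
      rcases body_prefix_cases (hL m t b hb) h₁ h₂ with ⟨r, rfl⟩ | ⟨w', rfl, h₃, h₄⟩
      · obtain ⟨w', hw'⟩ := hu.exists_of_nonempty hne'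
        exact ⟨r ++ .iface (.ret t m ()) :: w', by simpa using Fills.call m hb hw'⟩
      · rcases eq_or_ne w' [] with rfl | hw
        · obtain ⟨w', hw'⟩ := hu.exists_of_nonempty hne'
          exact ⟨w', by simpa using Fills.call m hb hw'⟩
        · obtain ⟨w', hw'⟩ := ih hne' h₃ ⟨y, hy, h₄⟩ hw
          exact ⟨w', by simpa using Fills.call m hb hw'⟩
    · simp [partThread] at h₁

theorem clientThread_tid {n : ℕ} {η : Method → ThreadID → Set (Trace Unit PComm Method)}
    (hη : PrimitiveBodies η) (C : Client PComm Method n) :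
    ∀ t, ∀ w ∈ {τ | ∃ h : t < n, τ ∈ (C ⟨t, h⟩).traces η t}, ∀ φ ∈ w, φ.tid = t := by
  rintro t w ⟨h, hw⟩
  obtain ⟨u, -, hu⟩ := Cmd.exists_fills hw
  exact hu.tid_eq hη

/-- The number of threads of the most general client is unbounded, and every thread may stay idle,
so only the single threads impose conditions. -/
theorem mem_libraryTraces_iff {L : Library PComm Method}
    (hL : PrimitiveBodies (Library.bodyTraces L)) {τ : Trace Unit PComm Method} :
    τ ∈ libraryTraces L ↔ ∀ t, threadProj τ t ∈ prefixClosure (mgcTraces L t) := by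
  constructor
  · rintro ⟨w, ⟨k, -, hw⟩, hτ⟩ t
    obtain ⟨h₁, h₂⟩ := (mem_prefixClosure_parTraces (mgcTraces_tid hL)).1 ⟨w, hw, hτ⟩
    by_cases ht : t < k
    · exact h₂ t ht
    · rw [threadProj_eq_nil fun φ hφ h => ht (lt_of_eq_of_lt h.symm (h₁ φ hφ))]
      exact subset_prefixClosure (starSet_nil _)
  · intro h
    -- The sum of all thread identifiers in `τ`, plus one, exceeds each of them and is at least one,
    -- so it can serve as the number of threads.
    have hk : ∀ φ ∈ τ, φ.tid < (τ.map Act.tid).sum + 1 := fun φ hφ =>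
      Nat.lt_succ_of_le (List.le_sum_of_mem (List.mem_map_of_mem hφ))
    obtain ⟨w, hw, hτ⟩ := (mem_prefixClosure_parTraces (mgcTraces_tid hL)).2
      ⟨hk, fun t _ => h t⟩
    exact ⟨w, ⟨_, Nat.le_add_left .., hw⟩, hτ⟩

theorem part_true_mem_libraryTraces {n : ℕ} {L : Library PComm Method}
    (hL : PrimitiveBodies (Library.bodyTraces L)) {C : Client PComm Method n}
    {τ : Trace Unit PComm Method} (hτ : τ ∈ completeTraces L C) :
    part true (fun _ => false) τ ∈ libraryTraces L := by
  rw [mem_libraryTraces_iff hL]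
  intro t
  obtain ⟨h₁, h₂⟩ := (mem_prefixClosure_parTraces (clientThread_tid hL C)).1 hτ
  rw [threadProj_part]
  by_cases ht : t < n
  · obtain ⟨w, ⟨_, hw⟩, hτw⟩ := h₂ t ht
    obtain ⟨u, -, hu⟩ := Cmd.exists_fills hw
    exact ⟨_, hu.partThread_true hL, partThread_prefix _ _ hτw⟩
  · rw [threadProj_eq_nil fun φ hφ h => ht (lt_of_eq_of_lt h.symm (h₁ φ hφ))]
    exact subset_prefixClosure (starSet_nil _)

theorem part_false_mem_clientTraces {n : ℕ} {L : Library PComm Method}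
    (hL : PrimitiveBodies (Library.bodyTraces L)) {C : Client PComm Method n}
    {τ : Trace Unit PComm Method} (hτ : τ ∈ completeTraces L C) :
    part false (fun _ => false) τ ∈ clientTraces C := by
  obtain ⟨h₁, h₂⟩ := (mem_prefixClosure_parTraces (clientThread_tid hL C)).1 hτ
  refine (mem_prefixClosure_parTraces (clientThread_tid primitiveBodies_emptyBodies C)).2
    ⟨fun φ hφ => ?_, fun t ht => ?_⟩
  · by_contra hn
    have hnil : threadProj τ φ.tid = [] := threadProj_eq_nil fun φ' hφ' h => hn (h ▸ h₁ φ' hφ')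
    have := threadProj_part false (fun _ => false) τ φ.tid
    rw [hnil, partThread] at this
    exact List.eq_nil_iff_forall_not_mem.1 this φ (List.mem_filter.2 ⟨hφ, by simp⟩)
  · obtain ⟨w, ⟨_, hw⟩, hτw⟩ := h₂ t ht
    obtain ⟨u, hu, hf⟩ := Cmd.exists_fills hw
    rw [threadProj_part]
    refine ⟨u, ⟨ht, hu⟩, ?_⟩
    rw [← hf.partThread_false hL]
    exact partThread_prefix _ _ hτw

/-- On each thread the client part prescribes the sequence of calls and the library part the bodies
executed so far. The unfinished remainder can be filled in because every method that the client
calls has a body trace. -/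
theorem mem_completeTraces_of_parts {n : ℕ} {L : Library PComm Method} {Γ : Spec S Method}
    (hL : LibraryHasSpec L Γ) {C : Client PComm Method n} (hC : ClientHasSpec Γ C)
    {τ : Trace Unit PComm Method} (h₁ : part false (fun _ => false) τ ∈ clientTraces C)
    (h₂ : part true (fun _ => false) τ ∈ libraryTraces L) : τ ∈ completeTraces L C := by
  rw [mem_libraryTraces_iff hL.primitiveBodies] at h₂
  obtain ⟨h₃, h₄⟩ := (mem_prefixClosure_parTraces
    (clientThread_tid primitiveBodies_emptyBodies C)).1 h₁
  refine (mem_prefixClosure_parTraces (clientThread_tid hL.primitiveBodies C)).2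
    ⟨fun φ hφ => ?_, fun t ht => ?_⟩
  · by_contra hn
    -- A thread outside the client has an empty client part; since it starts outside every method,
    -- it has performed nothing at all.
    have hnil := threadProj_eq_nil (t := φ.tid) fun φ' hφ' h => hn (h ▸ h₃ φ' hφ')
    rw [threadProj_part] at hnil
    exact List.eq_nil_iff_forall_not_mem.1 (partThread_false_eq_nil hnil) φ
      (List.mem_filter.2 ⟨hφ, by simp⟩)
  · obtain ⟨u, ⟨_, hu⟩, hτu⟩ := h₄ t ht
    have h₂t := h₂ t
    rw [threadProj_part] at hτu h₂t
    obtain ⟨w', hw'⟩ := Fills.extend hL.primitiveBodies (Cmd.fills_self hu)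
      (fun m hm => hL.bodyTraces_nonempty (hC ⟨t, ht⟩ m (Cmd.mem_methods_of_call hu hm)) t)
      hτu h₂t
    exact ⟨_, ⟨ht, Cmd.mem_traces_of_fills hu hw'⟩, List.prefix_append ..⟩

end Parts

/-! ### Splitting a run of the program into local runs; safety -/

section Decomposition

variable {S PComm Method : Type*} [SepAlgebra S]

/-- The trace `κ` is executed by a client, starting from `σc₀` and reaching `σc`, while the
footprint of the state of the library it calls changes from that of `σl₀` to that of `σl`. -/
inductive JointRun (f : Transformers S PComm) (Γ : Spec S Method) (σc₀ σl₀ : S) :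
    Trace S PComm Method → S → S → Prop
  | init : JointRun f Γ σc₀ σl₀ [] σc₀ σl₀
  | client {κ : Trace S PComm Method} {σc σl : S} {t : ThreadID} {c : PComm} {p : Set S}
      {σc' : S} : JointRun f Γ σc₀ σl₀ κ σc σl → inside (fun _ => false) κ t = false →
      f t c σc = .ok p → σc' ∈ p → JointRun f Γ σc₀ σl₀ (κ ++ [.prim t c]) σc' σl
  | library {κ : Trace S PComm Method} {σc σl σl' : S} : JointRun f Γ σc₀ σl₀ κ σc σl →
      foot σl' = foot σl → JointRun f Γ σc₀ σl₀ κ σc σl'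
  | call {κ : Trace S PComm Method} {σc σl : S} {t : ThreadID} {m : Method} {s : MethodSpec S}
      {a σc' σl' : S} : JointRun f Γ σc₀ σl₀ κ σc σl → inside (fun _ => false) κ t = false →
      Γ m = some s → op σc' a = some σc → op σl a = some σl' →
      JointRun f Γ σc₀ σl₀ (κ ++ [.iface (.call t m a)]) σc' σl'
  | ret {κ : Trace S PComm Method} {σc σl : S} {t : ThreadID} {m : Method}
      {a σc' σl' : S} : JointRun f Γ σc₀ σl₀ κ σc σl →
      op σc a = some σc' → op σl' a = some σl →
      JointRun f Γ σc₀ σl₀ (κ ++ [.iface (.ret t m a)]) σc' σl'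

/-- An execution of `τ` from `σ₀ = σc₀ * σl₀` to `σ` is composed of executions of a client
and of a library. -/
def Decomposes (f : Transformers S PComm) (Γ : Spec S Method) (σc₀ σl₀ : S)
    (τ : Trace Unit PComm Method) (σ : S) : Prop :=
  ∃ κ ξ σc σl, op σc σl = some σ ∧ JointRun f Γ σc₀ σl₀ κ σc σl ∧
    Runs (evalClient f Γ) σc₀ κ σc ∧ Runs (evalLibrary f Γ) σl₀ ξ σl ∧
    κ.map Act.erase = part false (fun _ => false) τ ∧
    ξ.map Act.erase = part true (fun _ => false) τ ∧ history κ = history ξ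

variable {f : Transformers S PComm} {Γ : Spec S Method} {n : ℕ} {C : Client PComm Method n}
  {L : Library PComm Method}

/-- The component that owns a command cannot fault on its own factor, and strong locality carries
its result over to the product. At a call, the client's safety yields a piece in the precondition,
and the library may receive any such compatible piece; at a return the roles are exchanged.
Reassociating the product moves the piece, so the global state stays the same. -/
theorem Decomposes.step (hfp : FootprintPreserving f) (hsl : StronglyLocal f)
    (hL : PrimitiveBodies (Library.bodyTraces L)) {σc₀ σl₀ : S}
    (hc : NeverFaults (evalClient f Γ) (clientTraces C) σc₀)
    (hl : NeverFaults (evalLibrary f Γ) (libraryTraces L) σl₀)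
    {τ : Trace Unit PComm Method} {φ : Act Unit PComm Method} {σ : S}
    (hτ : τ ++ [φ] ∈ completeTraces L C) (h : Decomposes f Γ σc₀ σl₀ τ σ) :
    ∃ Z, evalComplete f φ σ = .ok Z ∧
      ∀ σ', (σ', φ) ∈ Z → Decomposes f Γ σc₀ σl₀ (τ ++ [φ]) σ' := by
  obtain ⟨κ, ξ, σc, σl, hσ, hJ, hκ, hξ, hκe, hξe, hh⟩ := h
  have hτc := part_false_mem_clientTraces hL hτ
  have hτl := part_true_mem_libraryTraces hL hτ
  -- The most general client never nests calls, so a calling thread is outside every method;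
  -- `JointRun.call` records this.
  have halt : Alternates (fun _ => false) (part true (fun _ => false) (τ ++ [φ])) :=
    alternates_of_threads fun t => mgcTraces_alternates hL ((mem_libraryTraces_iff hL).1 hτl t)
  have hin : inside (fun _ => false) κ = inside (fun _ => false) τ := by
    rw [← inside_map_erase, hκe, inside_part]
  unfold Decomposes
  rw [part_append, ← hκe] at hτc
  rw [part_append, ← hξe] at hτl
  rw [part_append, alternates_append, inside_part] at halt
  simp only [part_append, ← hκe, ← hξe]
  rcases φ with ((⟨t, m, ⟨⟩⟩ | ⟨t, m, ⟨⟩⟩) | ⟨t, c⟩)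
  · have hf := hc κ _ σc hτc hκ
    have hf' := hl ξ _ σl hτl hξ
    refine ⟨_, rfl, fun σ' hσ' => ?_⟩
    obtain rfl : σ' = σ := (Prod.ext_iff.1 hσ').1
    obtain ⟨Z, hZ⟩ := ok_of_ne_fault hf
    obtain ⟨Z', hZ'⟩ := ok_of_ne_fault hf'
    have hZc := hZ
    have hZl := hZ'
    simp only [evalClient, evalLibrary] at hZ hZ'
    cases hΓ : Γ m with
    | none => simp [hΓ] at hZ
    | some s =>
      simp only [hΓ] at hZ hZ'
      obtain ⟨⟨a, ha, σc', hop⟩, hZ⟩ := giveUp_eq_ok hZ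
      have hZ' := receive_eq_ok hZ'
      obtain ⟨σl', h₁, h₂⟩ := op_assoc_left hop hσ
      have h₁' := op_comm_of h₁
      refine ⟨κ ++ [.iface (.call t m a)], ξ ++ [.iface (.call t m a)], σc', σl', h₂,
        .call hJ ?_ hΓ hop h₁', hκ.snoc (φ := .iface (.call t m a)) hZc ?_,
        hξ.snoc (φ := .iface (.call t m a)) hZl ?_, by rw [List.map_append]; rfl,
        by rw [List.map_append]; rfl, ?_⟩
      · rw [hin]
        simpa [part, Alternates, CallRetAct.isCall, CallRetAct.tid] using halt.2
      · rw [hZ]; exact ⟨a, ha, hop, rfl⟩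
      · rw [hZ']; exact ⟨a, ha, h₁', rfl⟩
      · rw [history_append, history_append, hh]
  · have hf := hc κ _ σc hτc hκ
    have hf' := hl ξ _ σl hτl hξ
    refine ⟨_, rfl, fun σ' hσ' => ?_⟩
    obtain rfl : σ' = σ := (Prod.ext_iff.1 hσ').1
    obtain ⟨Z, hZ⟩ := ok_of_ne_fault hf
    obtain ⟨Z', hZ'⟩ := ok_of_ne_fault hf'
    have hZc := hZ
    have hZl := hZ'
    simp only [evalClient, evalLibrary] at hZ hZ'
    cases hΓ : Γ m with
    | none => simp [hΓ] at hZ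
    | some s =>
      simp only [hΓ] at hZ hZ'
      have hZ := receive_eq_ok hZ
      obtain ⟨⟨a, ha, σl', hop⟩, hZ'⟩ := giveUp_eq_ok hZ'
      obtain ⟨σc', h₁, h₂⟩ := op_assoc_right (op_comm_of hop) hσ
      refine ⟨κ ++ [.iface (.ret t m a)], ξ ++ [.iface (.ret t m a)], σc', σl', h₂,
        .ret hJ h₁ hop, hκ.snoc (φ := .iface (.ret t m a)) hZc ?_,
        hξ.snoc (φ := .iface (.ret t m a)) hZl ?_, by rw [List.map_append]; rfl,
        by rw [List.map_append]; rfl, ?_⟩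
      · rw [hZ]; exact ⟨a, ha, h₁, rfl⟩
      · rw [hZ']; exact ⟨a, ha, hop, rfl⟩
      · rw [history_append, history_append, hh]
  · cases ht : inside (fun _ => false) τ t with
    | false =>
      simp only [part, ht, if_true, Bool.false_eq_true, if_false, List.append_nil] at hτc hτl ⊢
      obtain ⟨p, hp⟩ := evalPrim_ne_fault (hc κ _ σc hτc hκ)
      refine ⟨_, evalPrim_of_ok (hsl t c σc σl σ p hσ hp), ?_⟩
      rintro σ' ⟨⟨σc', hσc', b, hb, hop⟩, -⟩
      rw [Set.mem_singleton_iff.1 hb] at hop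
      refine ⟨κ ++ [.prim t c], ξ, σc', σl, hop, .client hJ (by rw [hin, ht]) hp hσc',
        hκ.snoc (φ := .prim t c) (evalPrim_of_ok hp) ⟨hσc', rfl⟩, hξ, by rw [List.map_append]; rfl,
        rfl, ?_⟩
      rw [history_append, hh]
      simp
    | true =>
      simp only [part, ht, if_true, Bool.true_eq_false, if_false, List.append_nil] at hτc hτl ⊢
      obtain ⟨p, hp⟩ := evalPrim_ne_fault (hl ξ _ σl hτl hξ)
      refine ⟨_, evalPrim_of_ok (hsl t c σl σc σ p (op_comm_of hσ) hp), ?_⟩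
      rintro σ' ⟨⟨σl', hσl', b, hb, hop⟩, -⟩
      rw [Set.mem_singleton_iff.1 hb] at hop
      refine ⟨κ, ξ ++ [.prim t c], σc, σl', op_comm_of hop,
        .library hJ (hfp t c σl p hp σl' hσl'), hκ,
        hξ.snoc (φ := .prim t c) (evalPrim_of_ok hp) ⟨hσl', rfl⟩, rfl, by rw [List.map_append]; rfl,
        ?_⟩
      rw [history_append, hh]
      simp

theorem prefixClosure_of_snoc {α : Type*} {T : Set (List α)} (x : List α) (a : α)
    (h : x ++ [a] ∈ prefixClosure T) : x ∈ prefixClosure T :=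
  prefixClosure_of_prefix h (List.prefix_append ..)

theorem decomposes_of_runs (hfp : FootprintPreserving f) (hsl : StronglyLocal f)
    (hL : PrimitiveBodies (Library.bodyTraces L)) {σc₀ σl₀ σ₀ : S}
    (hc : NeverFaults (evalClient f Γ) (clientTraces C) σc₀)
    (hl : NeverFaults (evalLibrary f Γ) (libraryTraces L) σl₀)
    (h₀ : op σc₀ σl₀ = some σ₀) (τ : Trace Unit PComm Method) :
    ∀ {σ : S}, τ ∈ completeTraces L C → Runs (evalComplete f) σ₀ τ σ →
      Decomposes f Γ σc₀ σl₀ τ σ := by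
  induction τ using List.reverseRecOn with
  | nil =>
    rintro σ - rfl
    exact ⟨[], [], σc₀, σl₀, h₀, .init, rfl, rfl, rfl, rfl, rfl⟩
  | append_singleton τ φ ih =>
    intro σ hτ h
    obtain ⟨σ₁, Z, h₁, h₂, h₃⟩ := runs_snoc.1 h
    obtain ⟨Z', h₄, h₅⟩ := (ih (prefixClosure_of_snoc _ _ hτ) h₁).step hfp hsl hL hc hl hτ
    rw [Act.erase_unit, h₄] at h₂
    cases h₂
    exact h₅ σ h₃

theorem neverFaults_complete (hfp : FootprintPreserving f) (hsl : StronglyLocal f)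
    (hL : PrimitiveBodies (Library.bodyTraces L)) {σc₀ σl₀ σ₀ : S}
    (hc : NeverFaults (evalClient f Γ) (clientTraces C) σc₀)
    (hl : NeverFaults (evalLibrary f Γ) (libraryTraces L) σl₀)
    (h₀ : op σc₀ σl₀ = some σ₀) : NeverFaults (evalComplete f) (completeTraces L C) σ₀ := by
  intro τ φ σ hτ h
  rw [map_erase_unit] at hτ
  obtain ⟨Z, hZ, -⟩ := (decomposes_of_runs hfp hsl hL hc hl h₀ τ
    (prefixClosure_of_snoc _ _ hτ) h).step hfp hsl hL hc hl hτ
  simp [hZ]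

theorem safe_complete (hfp : FootprintPreserving f) (hsl : StronglyLocal f)
    (hL : PrimitiveBodies (Library.bodyTraces L)) {I J : Set S}
    (hI : Safe (clientSem f Γ C) I) (hJ : Safe (librarySem f L Γ) J) :
    Safe (completeSem f C L) (setOp I J) := by
  rintro σ₀ ⟨σc₀, hσc₀, σl₀, hσl₀, h₀⟩
  refine (denote_ne_fault_iff (onlyAnnotates_evalComplete f) prefixClosure_of_snoc).2 ?_
  exact neverFaults_complete hfp hsl hL
    ((denote_ne_fault_iff (onlyAnnotates_evalClient f Γ) prefixClosure_of_snoc).1 (hI σc₀ hσc₀))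
    ((denote_ne_fault_iff (onlyAnnotates_evalLibrary f Γ) prefixClosure_of_snoc).1 (hJ σl₀ hσl₀))
    h₀

end Decomposition

/-! ### Replaying the client against a reordered library run -/

section Simulation

variable {S PComm Method ι : Type*}

def CallRetAct.method {A : Type*} : CallRetAct A Method → Method
  | .call _ m _ => m
  | .ret _ m _ => m

/-- The annotation of an action. -/
def CallRetAct.payload {A : Type*} : CallRetAct A Method → A
  | .call _ _ a => a
  | .ret _ _ a => a

/-- `K₂` is a permutation of `K₁` that preserves the order of returns and subsequent calls;
`act` gives the actions performed at distinct points of a history. -/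
structure Reorders {A : Type*} (act : ι → CallRetAct A Method) (K₁ K₂ : List ι) : Prop where
  perm : K₁.Perm K₂
  nodup : K₁.Nodup
  order : ∀ i j, [i, j].Sublist K₁ → (act i).isCall = false → (act j).isCall = true →
    [i, j].Sublist K₂

theorem Reorders.nodup_right {A : Type*} {act : ι → CallRetAct A Method} {K₁ K₂ : List ι}
    (h : Reorders act K₁ K₂) : K₂.Nodup :=
  h.perm.nodup_iff.1 h.nodup

theorem Reorders.erase [DecidableEq ι] {A : Type*} {act : ι → CallRetAct A Method}
    {K₁ K₂ : List ι} (h : Reorders act K₁ K₂) (i : ι) :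
    Reorders act (K₁.erase i) (K₂.erase i) where
  perm := h.perm.erase i
  nodup := h.nodup.erase i
  order j k hjk hj hk := by
    have hmem : ∀ x ∈ [j, k], x ≠ i := fun x hx =>
      (h.nodup.mem_erase_iff.1 (hjk.subset hx)).1
    have := (h.order j k (hjk.trans List.erase_sublist) hj hk).erase i
    rwa [List.erase_of_not_mem fun hi => hmem i hi rfl] at this

/-- The trace of the calls and returns in `K`, without annotations. -/
def actTrace (PComm : Type*) {A : Type*} (act : ι → CallRetAct A Method) (K : List ι) :
    Trace Unit PComm Method :=
  K.map fun i => .iface (act i).erase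

section

variable {A : Type*} {act : ι → CallRetAct A Method} {K : List ι} {t : ThreadID}

theorem threadProj_actTrace_append_singleton_of_ne {i : ι} (h : (act i).tid ≠ t) :
    threadProj (actTrace PComm act (K ++ [i])) t = threadProj (actTrace PComm act K) t := by
  rw [actTrace, List.map_append, threadProj_append, List.map_singleton,
    threadProj_cons_of_ne (by simpa [Act.tid] using h)]
  exact List.append_nil _

theorem threadProj_actTrace_append_singleton (i : ι) :
    threadProj (actTrace PComm act (K ++ [i])) (act i).tid =
      threadProj (actTrace PComm act K) (act i).tid ++ [.iface (act i).erase] := by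
  rw [actTrace, List.map_append, threadProj_append, List.map_singleton,
    threadProj_cons_of_eq (by simp [Act.tid])]
  rfl

theorem threadProj_actTrace_eq_nil (h : t ∉ K.map fun i => (act i).tid) :
    threadProj (actTrace PComm act K) t = [] := by
  refine threadProj_eq_nil ?_
  rintro φ hφ rfl
  obtain ⟨i, hi, rfl⟩ := List.mem_map.1 hφ
  exact h (List.mem_map.2 ⟨i, hi, by simp [Act.tid]⟩)

theorem threadProj_actTrace_erase_of_ne [DecidableEq ι] {i : ι} (h : (act i).tid ≠ t) :
    threadProj (actTrace PComm act (K.erase i)) t = threadProj (actTrace PComm act K) t := by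
  by_cases hi : i ∈ K
  · obtain ⟨K₁, K₂, -, rfl, he⟩ := List.exists_erase_eq hi
    rw [he]
    simp only [actTrace, List.map_append, List.map_cons, threadProj_append]
    rw [threadProj_cons_of_ne (by simpa [Act.tid] using h)]
  · rw [List.erase_of_not_mem hi]

theorem threadProj_actTrace_of_mem {i : ι} (hi : i ∈ K)
    (hK : (K.map fun i => (act i).tid).Nodup) :
    threadProj (actTrace PComm act K) (act i).tid = [.iface (act i).erase] := by
  obtain ⟨K₁, K₂, rfl⟩ := List.append_of_mem hi
  rw [List.map_append, List.map_cons, List.nodup_middle, List.nodup_cons, List.mem_append,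
    not_or] at hK
  have h₁ := threadProj_actTrace_eq_nil (PComm := PComm) hK.1.1
  have h₂ := threadProj_actTrace_eq_nil (PComm := PComm) hK.1.2
  rw [actTrace] at h₁ h₂ ⊢
  rw [List.map_append, List.map_cons, threadProj_append, h₁,
    threadProj_cons_of_eq (by simp [Act.tid]), h₂]
  rfl

end

variable [SepAlgebra S]

theorem runs_library_prim {f : Transformers S PComm} {Γ : Spec S Method} {t : ThreadID}
    {c : PComm} {ξ : Trace S PComm Method} {σ σ' : S}
    (h : Runs (evalLibrary f Γ) σ (.prim t c :: ξ) σ') :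
    ∃ p, f t c σ = .ok p ∧ ∃ σ₁ ∈ p, Runs (evalLibrary f Γ) σ₁ ξ σ' := by
  obtain ⟨Z, σ₁, h₁, h₂, h₃⟩ := h
  obtain ⟨p, hp, rfl⟩ := evalPrim_ok h₁
  exact ⟨p, hp, σ₁, h₂.1, h₃⟩

theorem runs_library_iface {f : Transformers S PComm} {Γ : Spec S Method}
    {ψ : CallRetAct S Method} {ξ : Trace S PComm Method} {σ σ' : S}
    (h : Runs (evalLibrary f Γ) σ (.iface ψ :: ξ) σ') :
    ∃ σ₁, (if ψ.isCall then op σ ψ.payload = some σ₁ else op σ₁ ψ.payload = some σ) ∧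
      Runs (evalLibrary f Γ) σ₁ ξ σ' := by
  obtain ⟨Z, σ₁, h₁, h₂, h₃⟩ := h
  refine ⟨σ₁, ?_, h₃⟩
  rcases ψ with ⟨t, m, a⟩ | ⟨t, m, a⟩
  · simp only [Act.erase, CallRetAct.erase, evalLibrary] at h₁
    split at h₁
    · cases h₁
    · rw [receive_eq_ok h₁] at h₂
      obtain ⟨b, -, h₄, h₅⟩ := h₂
      cases h₅
      exact h₄
  · simp only [Act.erase, CallRetAct.erase, evalLibrary] at h₁
    split at h₁
    · cases h₁
    · rw [(giveUp_eq_ok h₁).2] at h₂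
      obtain ⟨b, -, h₄, h₅⟩ := h₂
      cases h₅
      exact h₄

/-- A complete program has executed `τ`, following the client trace `κ`. Its library has
executed the part `α` of the library trace `α ++ β`, except that it has already performed the
calls in `E`, which occur in `β`, and has not yet performed the returns in `D`, which occur
in `α`. The remaining calls and returns of the client are those in `K₁`. -/
structure Simulates (f : Transformers S PComm) (Γ : Spec S Method) (σ₀ : S)
    (act : ι → CallRetAct S Method) (ξ κ : Trace S PComm Method) (σc : S) (K₁ : List ι)
    (τ : Trace Unit PComm Method) (α β : Trace S PComm Method) (E D K₂ : List ι)
    (σα σl : S) : Prop where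
  run : ∃ σ, Runs (evalComplete f) σ₀ τ σ ∧ op σc σl = some σ
  rest : ∃ σ', Runs (evalLibrary f Γ) σα β σ'
  alternates : Alternates (inside (fun _ => false) α) β
  history_rest : history β = K₂.map act
  split : α ++ β = ξ
  adds : Adds σα ((E ++ D).map fun i => (act i).payload) σl
  calls : ∀ i ∈ E, (act i).isCall = true ∧ (Γ (act i).method).isSome
  rets : ∀ i ∈ D, (act i).isCall = false
  reorders : Reorders act (E ++ K₁) (D ++ K₂)
  nodup : ((E ++ D).map fun i => (act i).tid).Nodup
  busy : ∀ i ∈ E ++ D, inside (fun _ => false) α (act i).tid = false ∧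
    inside (fun _ => false) τ (act i).tid = true
  idle : ∀ t, t ∉ ((E ++ D).map fun i => (act i).tid) →
    inside (fun _ => false) τ t = inside (fun _ => false) α t
  threads : ∀ t, threadProj (part true (fun _ => false) τ) t ++
      threadProj (actTrace PComm act D) t =
    threadProj (α.map Act.erase) t ++ threadProj (actTrace PComm act E) t
  client : part false (fun _ => false) τ = κ.map Act.erase

variable {f : Transformers S PComm} {Γ : Spec S Method} {σ₀ : S}
  {act : ι → CallRetAct S Method} {ξ κ : Trace S PComm Method} {σc : S} {K₁ : List ι}
  {τ : Trace Unit PComm Method} {α β : Trace S PComm Method} {E D K₂ : List ι} {σα σl : S}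

theorem Simulates.inside_client (h : Simulates f Γ σ₀ act ξ κ σc K₁ τ α β E D K₂ σα σl) :
    inside (fun _ => false) τ = inside (fun _ => false) κ := by
  rw [← inside_part false, h.client, inside_map_erase]

/-- A pending thread is inside a method in `τ` but outside in `α`: for `E` because `α` has yet to
make the call, for `D` because `α` has already returned. Either condition in `ht` excludes this. -/
theorem Simulates.not_pending (h : Simulates f Γ σ₀ act ξ κ σc K₁ τ α β E D K₂ σα σl)
    {t : ThreadID} (ht : inside (fun _ => false) α t = true ∨ inside (fun _ => false) τ t = false) :
    t ∉ ((E ++ D).map fun i => (act i).tid) := by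
  intro hm
  obtain ⟨i, hi, rfl⟩ := List.mem_map.1 hm
  obtain ⟨h₁, h₂⟩ := h.busy i hi
  simp [h₁, h₂] at ht

theorem Simulates.client_prim (hfp : FootprintPreserving f) (hsl : StronglyLocal f)
    (h : Simulates f Γ σ₀ act ξ κ σc K₁ τ α β E D K₂ σα σl) {t : ThreadID} {c : PComm}
    {p : Set S} {σc' : S} (ht : inside (fun _ => false) κ t = false) (hp : f t c σc = .ok p)
    (hσ : σc' ∈ p) :
    Simulates f Γ σ₀ act ξ (κ ++ [.prim t c]) σc' K₁ (τ ++ [.prim t c]) α β E D K₂ σα σl := by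
  have hin : inside (fun _ => false) (τ ++ [.prim t c]) = inside (fun _ => false) τ := by
    simp [inside_append, nextInside]
  have ht' : inside (fun _ => false) τ t = false := by rw [h.inside_client, ht]
  refine { h with run := ?_, busy := ?_, idle := ?_, threads := ?_, client := ?_ }
  · obtain ⟨σ, h₁, h₂⟩ := h.run
    obtain ⟨p', σ', h₃, h₄, h₅⟩ := Transformers.frame hfp hsl hp hσ h₂
    exact ⟨σ', h₁.snoc (φ := .prim t c) (evalPrim_of_ok h₃) ⟨h₄, rfl⟩, h₅⟩
  · rw [hin]; exact h.busy
  · rw [hin]; exact h.idle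
  · simpa [part_append, part, ht'] using h.threads
  · simp [part_append, part, ht', h.client, Act.erase]

/-- The call is executed without running the library trace; its piece joins the frame, and the call
is noted in `E` until `β` reaches it. -/
theorem Simulates.call (h : Simulates f Γ σ₀ act ξ κ σc (i :: K₁) τ α β E D K₂ σα σl)
    {σc' σl' : S} (hi : (act i).isCall = true) (hΓ : (Γ (act i).method).isSome)
    (hin : inside (fun _ => false) κ (act i).tid = false)
    (hc : op σc' (act i).payload = some σc) (hl : op σl (act i).payload = some σl') :
    Simulates f Γ σ₀ act ξ (κ ++ [.iface (act i)]) σc' K₁ (τ ++ [.iface (act i).erase]) α β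
      (E ++ [i]) D K₂ σα σl' := by
  have ht : inside (fun _ => false) τ (act i).tid = false := by rw [h.inside_client, hin]
  have hnp := h.not_pending (Or.inr ht)
  have hα := (h.idle _ hnp).symm.trans ht
  have hperm : ((E ++ [i]) ++ D).Perm (i :: (E ++ D)) := by
    rw [List.append_assoc]
    exact List.perm_middle
  have hτ : inside (fun _ => false) (τ ++ [.iface (act i).erase]) =
      Function.update (inside (fun _ => false) τ) (act i).tid true := by
    simp [inside_append, nextInside, hi]
  refine { h with
    run := ?_, adds := ?_, calls := ?_, reorders := ?_, nodup := ?_, busy := ?_, idle := ?_,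
    threads := ?_, client := ?_ }
  · obtain ⟨σ, h₁, h₂⟩ := h.run
    -- The total state does not change: reassociation moves the piece from the client factor to the
    -- library factor.
    obtain ⟨σl'', h₃, h₄⟩ := op_assoc_left hc h₂
    rw [op_comm, hl] at h₃
    cases h₃
    exact ⟨σ, h₁.snoc (φ := .iface (act i).erase) rfl (by simp), h₄⟩
  · refine (h.adds.append_singleton hl).perm ?_
    rw [← List.map_singleton (f := fun i => (act i).payload), ← List.map_append]
    exact ((List.perm_append_singleton i (E ++ D)).trans hperm.symm).map _
  · intro j hj
    rcases List.mem_append.1 hj with hj | hj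
    · exact h.calls j hj
    · rw [List.mem_singleton.1 hj]
      exact ⟨hi, hΓ⟩
  · simpa using h.reorders
  · rw [(hperm.map _).nodup_iff]
    exact List.nodup_cons.2 ⟨hnp, h.nodup⟩
  · intro j hj
    rw [hτ]
    rcases List.mem_cons.1 (hperm.mem_iff.1 hj) with rfl | hj
    · exact ⟨hα, Function.update_self ..⟩
    · rw [Function.update_of_ne fun he => hnp (List.mem_map.2 ⟨j, hj, he⟩)]
      exact h.busy j hj
  · intro t ht'
    rw [(hperm.map _).mem_iff, List.map_cons, List.mem_cons, not_or] at ht'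
    rw [hτ, Function.update_of_ne ht'.1]
    exact h.idle t ht'.2
  · intro t
    have hth := h.threads t
    rw [part_append, part, part, threadProj_append]
    by_cases he : (act i).tid = t
    · subst he
      rw [List.map_append, List.mem_append, not_or] at hnp
      rw [threadProj_cons_of_eq (by simp [Act.tid]), threadProj_actTrace_append_singleton,
        ← List.append_assoc, ← hth, threadProj_actTrace_eq_nil hnp.2]
      simp [threadProj]
    · rw [threadProj_cons_of_ne (by simpa [Act.tid] using he),
        threadProj_actTrace_append_singleton_of_ne he, ← hth]
      simp [threadProj]
  · simp [part_append, part, h.client, Act.erase]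

/-- The command's thread is inside a method in `α`, hence not pending, so it is inside in `τ` too
and the command again counts as a library action. The pieces of `E` and `D`, and then the client
state, are frames. -/
theorem Simulates.library_prim (hfp : FootprintPreserving f) (hsl : StronglyLocal f)
    {t : ThreadID} {c : PComm}
    (h : Simulates f Γ σ₀ act ξ κ σc K₁ τ α (.prim t c :: β) E D K₂ σα σl) :
    ∃ σα' σl', foot σl' = foot σl ∧
      Simulates f Γ σ₀ act ξ κ σc K₁ (τ ++ [.prim t c]) (α ++ [.prim t c]) β E D K₂ σα' σl' := by
  obtain ⟨ht, halt⟩ := h.alternates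
  have hnp := h.not_pending (Or.inl ht)
  have hτt := (h.idle t hnp).trans ht
  have hα : inside (fun _ => false) (α ++ [.prim t c]) = inside (fun _ => false) α := by
    simp [inside_append, nextInside]
  have hτ : inside (fun _ => false) (τ ++ [.prim t c]) = inside (fun _ => false) τ := by
    simp [inside_append, nextInside]
  obtain ⟨σe, hσe⟩ := h.rest
  obtain ⟨p, hp, σα', hσα', hrest⟩ := runs_library_prim hσe
  obtain ⟨p', σl', hp', hσl', hadds⟩ := Adds.frame hfp hsl hp hσα' h.adds
  refine ⟨σα', σl', hfp t c σl p' hp' σl' hσl', { h with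
    run := ?_, rest := ⟨σe, hrest⟩, alternates := ?_, history_rest := h.history_rest, split := ?_,
    adds := hadds, busy := ?_, idle := ?_, threads := ?_, client := ?_ }⟩
  · obtain ⟨σ, h₁, h₂⟩ := h.run
    obtain ⟨p'', σ', h₃, h₄, h₅⟩ := Transformers.frame hfp hsl hp' hσl' (op_comm_of h₂)
    exact ⟨σ', h₁.snoc (φ := .prim t c) (evalPrim_of_ok h₃) ⟨h₄, rfl⟩, op_comm_of h₅⟩
  · rwa [hα]
  · simpa using h.split
  · rw [hα, hτ]; exact h.busy
  · rw [hα, hτ]; exact h.idle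
  · intro u
    have hth := h.threads u
    rw [part_append, part, if_pos hτt, part, List.map_append, threadProj_append,
      threadProj_append]
    by_cases he : t = u
    · subst he
      rw [List.map_append, List.mem_append, not_or] at hnp
      rw [threadProj_actTrace_eq_nil hnp.1, threadProj_actTrace_eq_nil hnp.2] at hth ⊢
      simp only [List.append_nil] at hth ⊢
      rw [hth]
      rfl
    · rw [threadProj_cons_of_ne (by exact he), List.map_singleton,
        threadProj_cons_of_ne (by exact he)]
      simpa [threadProj] using hth
  · simpa [part_append, part, hτt] using h.client

/-- Only the bookkeeping changes. The library trace gives up a piece that the program retains in the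
library state, so the piece moves from `σα` to the frame and the return is postponed in `D`. -/
theorem Simulates.library_ret {j : ι} (hj : (act j).isCall = false)
    (h : Simulates f Γ σ₀ act ξ κ σc K₁ τ α (.iface (act j) :: β) E D (j :: K₂) σα σl) :
    ∃ σα', Simulates f Γ σ₀ act ξ κ σc K₁ τ (α ++ [.iface (act j)]) β E (D ++ [j]) K₂ σα' σl := by
  obtain ⟨ht, halt⟩ := h.alternates
  have ht : inside (fun _ => false) α (act j).tid = true := by simpa [hj] using ht
  have hnp := h.not_pending (Or.inl ht)
  have hτt := (h.idle _ hnp).trans ht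
  have hα : inside (fun _ => false) (α ++ [.iface (act j)]) =
      Function.update (inside (fun _ => false) α) (act j).tid false := by
    simp [inside_append, nextInside, hj]
  have hperm : (E ++ (D ++ [j])).Perm (j :: (E ++ D)) := by
    rw [← List.append_assoc]
    exact List.perm_append_singleton j (E ++ D)
  obtain ⟨σe, hσe⟩ := h.rest
  obtain ⟨σα', hop, hrest⟩ := runs_library_iface hσe
  simp only [hj, Bool.false_eq_true, if_false] at hop
  refine ⟨σα', { h with
    rest := ⟨σe, hrest⟩, alternates := ?_, history_rest := ?_, split := ?_, adds := ?_,
    rets := ?_, reorders := ?_, nodup := ?_, busy := ?_, idle := ?_, threads := ?_ }⟩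
  · rw [hj] at halt
    rwa [hα]
  · simpa using h.history_rest
  · simpa using h.split
  · exact Adds.perm (hperm.map _).symm ⟨σα, hop, h.adds⟩
  · intro k hk
    rcases List.mem_append.1 hk with hk | hk
    · exact h.rets k hk
    · rw [List.mem_singleton.1 hk, hj]
  · simpa using h.reorders
  · rw [(hperm.map _).nodup_iff]
    exact List.nodup_cons.2 ⟨hnp, h.nodup⟩
  · intro k hk
    rw [hα]
    rcases List.mem_cons.1 (hperm.mem_iff.1 hk) with rfl | hk
    · exact ⟨Function.update_self .., hτt⟩
    · rw [Function.update_of_ne fun he => hnp (List.mem_map.2 ⟨k, hk, he⟩)]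
      exact h.busy k hk
  · intro t ht'
    rw [(hperm.map _).mem_iff, List.map_cons, List.mem_cons, not_or] at ht'
    rw [hα, Function.update_of_ne ht'.1]
    exact h.idle t ht'.2
  · intro t
    have hth := h.threads t
    rw [List.map_append, threadProj_append, List.map_singleton]
    by_cases he : (act j).tid = t
    · subst he
      rw [List.map_append, List.mem_append, not_or] at hnp
      rw [threadProj_actTrace_append_singleton, ← List.append_assoc, hth,
        threadProj_actTrace_eq_nil hnp.1, threadProj_cons_of_eq (by rw [Act.tid_erase]; rfl)]
      simp [threadProj, Act.erase]
    · rw [threadProj_actTrace_append_singleton_of_ne he, hth,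
        threadProj_cons_of_ne (by rw [Act.tid_erase]; exact he)]
      simp [threadProj]

/-- Were the call `j` not in `E`, it would follow the return `i` in the client's order.
Linearization would then put `i` before `j` in the library's order as well, but only `D` precedes
`j` there, and `i` is not in `D`. -/
theorem Reorders.mem_of_head {i j : ι} {A : Type*} {act : ι → CallRetAct A Method}
    (h : Reorders act (E ++ i :: K₁) (D ++ j :: K₂)) (hi : (act i).isCall = false)
    (hj : (act j).isCall = true) (hiD : i ∉ D) : j ∈ E := by
  have hjm : j ∈ E ++ i :: K₁ := h.perm.mem_iff.2 (by simp)
  simp only [List.mem_append, List.mem_cons] at hjm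
  rcases hjm with hjE | rfl | hjK
  · exact hjE
  · simp [hi] at hj
  · have hsub : [i, j].Sublist (E ++ i :: K₁) :=
      ((List.singleton_sublist.2 hjK).cons_cons i).trans (List.sublist_append_right ..)
    have hsub := h.order i j hsub hi hj
    have hnd := h.nodup_right
    obtain ⟨l₁, l₂, he, h₁, h₂⟩ := List.sublist_append_iff.1 hsub
    rcases l₁ with _ | ⟨x, l₁⟩
    · rw [List.nil_append] at he
      subst he
      have hij : i ≠ j := fun he => by simp [he, hj] at hi
      rcases h₂ with _ | ⟨_, h₃⟩ | _
      · have := (List.nodup_append.1 hnd).2.1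
        exact absurd (h₃.subset (by simp)) (List.nodup_cons.1 this).1
      · exact absurd rfl hij
    · rw [List.cons_append, List.cons.injEq] at he
      exact absurd (h₁.subset (by simp [he.1])) hiD

variable [DecidableEq ι]

/-- A postponed return is carried out: its piece lies in the frame, so it can be split off the
library state and handed to the client. -/
theorem Simulates.ret (h : Simulates f Γ σ₀ act ξ κ σc (i :: K₁) τ α β E D K₂ σα σl)
    (hi : i ∈ D) {σc' : S} (hc : op σc (act i).payload = some σc') :
    ∃ σl', op σl' (act i).payload = some σl ∧
      Simulates f Γ σ₀ act ξ (κ ++ [.iface (act i)]) σc' K₁ (τ ++ [.iface (act i).erase]) α β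
        E (D.erase i) K₂ σα σl' := by
  have hr := h.rets i hi
  have hiE : i ∉ E := fun hE => by simpa [hr] using (h.calls i hE).1
  have hperm : (E ++ D).Perm (i :: (E ++ D.erase i)) :=
    ((List.perm_cons_erase hi).append_left E).trans List.perm_middle
  have hnd := (hperm.map fun i => (act i).tid).nodup_iff.1 h.nodup
  rw [List.map_cons, List.nodup_cons] at hnd
  have hτ : inside (fun _ => false) (τ ++ [.iface (act i).erase]) =
      Function.update (inside (fun _ => false) τ) (act i).tid false := by
    simp [inside_append, nextInside, hr]
  have hb := h.busy i (List.mem_append_right _ hi)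
  -- Listing the piece of `i` last among the added pieces exposes it as the final factor of `σl`.
  obtain ⟨σl', h₁, h₂⟩ := (h.adds.perm ((hperm.trans
    (List.perm_append_singleton i (E ++ D.erase i)).symm).map fun i => (act i).payload)
    |> fun h => by rw [List.map_append] at h; exact h.of_append_singleton)
  refine ⟨σl', h₂, { h with
    run := ?_, adds := h₁, rets := ?_, reorders := ?_, nodup := hnd.2, busy := ?_, idle := ?_,
    threads := ?_, client := ?_ }⟩
  · obtain ⟨σ, h₃, h₄⟩ := h.run
    obtain ⟨x, h₅, h₆⟩ := op_assoc_right (op_comm_of h₂) h₄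
    rw [hc] at h₅
    cases h₅
    exact ⟨σ, h₃.snoc (φ := .iface (act i).erase) rfl (by simp), h₆⟩
  · exact fun j hj => h.rets j (List.mem_of_mem_erase hj)
  · have := h.reorders.erase i
    rwa [List.erase_append_right _ hiE, List.erase_cons_head, List.erase_append_left _ hi] at this
  · intro j hj
    rw [hτ, Function.update_of_ne fun he => hnd.1 (List.mem_map.2 ⟨j, hj, he⟩)]
    exact h.busy j (hperm.mem_iff.2 (List.mem_cons_of_mem _ hj))
  · intro t ht
    rw [hτ]
    by_cases he : t = (act i).tid
    · subst he
      rw [Function.update_self, hb.1]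
    · rw [Function.update_of_ne he]
      refine h.idle t ?_
      rw [(hperm.map _).mem_iff, List.map_cons, List.mem_cons, not_or]
      exact ⟨he, ht⟩
  · intro t
    have hth := h.threads t
    rw [part_append, part, part, threadProj_append]
    by_cases he : (act i).tid = t
    · subst he
      have hD : (D.map fun i => (act i).tid).Nodup := by
        have := h.nodup
        rw [List.map_append] at this
        exact this.of_append_right
      rw [threadProj_actTrace_of_mem hi hD] at hth
      have hn := hnd.1
      rw [List.map_append, List.mem_append, not_or] at hn
      rw [threadProj_cons_of_eq (by simp [Act.tid]), threadProj_actTrace_eq_nil hn.2, ← hth]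
      simp [threadProj]
    · rw [threadProj_cons_of_ne (by simpa [Act.tid] using he),
        threadProj_actTrace_erase_of_ne he, ← hth]
      simp [threadProj]
  · simp [part_append, part, h.client, Act.erase]

/-- The program made this call earlier, so neither `τ` nor `σl` changes; the piece leaves the frame
and becomes part of the state of the library trace. -/
theorem Simulates.library_call {j : ι}
    (h : Simulates f Γ σ₀ act ξ κ σc K₁ τ α (.iface (act j) :: β) E D (j :: K₂) σα σl)
    (hjE : j ∈ E) :
    ∃ σα', Simulates f Γ σ₀ act ξ κ σc K₁ τ (α ++ [.iface (act j)]) β (E.erase j) D K₂ σα' σl := by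
  obtain ⟨ht, halt⟩ := h.alternates
  have hj := (h.calls j hjE).1
  have hjD : j ∉ D := fun hD => by simpa [hj] using h.rets j hD
  have hperm : (E ++ D).Perm (j :: (E.erase j ++ D)) :=
    (List.perm_cons_erase hjE).append_right D
  have hnd := (hperm.map fun i => (act i).tid).nodup_iff.1 h.nodup
  rw [List.map_cons, List.nodup_cons] at hnd
  have hb := h.busy j (List.mem_append_left _ hjE)
  have hα : inside (fun _ => false) (α ++ [.iface (act j)]) =
      Function.update (inside (fun _ => false) α) (act j).tid true := by
    simp [inside_append, nextInside, hj]
  obtain ⟨σe, hσe⟩ := h.rest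
  obtain ⟨σα', hop, hrest⟩ := runs_library_iface hσe
  simp only [hj, if_true] at hop
  refine ⟨σα', { h with
    rest := ⟨σe, hrest⟩, alternates := ?_, history_rest := ?_, split := ?_, adds := ?_,
    calls := ?_, reorders := ?_, nodup := hnd.2, busy := ?_, idle := ?_, threads := ?_ }⟩
  · rw [hj] at halt
    rwa [hα]
  · simpa using h.history_rest
  · simpa using h.split
  · obtain ⟨σ₁, h₁, h₂⟩ := h.adds.perm (hperm.map _)
    rw [hop] at h₁
    cases h₁
    exact h₂
  · exact fun k hk => h.calls k (List.mem_of_mem_erase hk)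
  · have := h.reorders.erase j
    rwa [List.erase_append_right _ hjD, List.erase_cons_head, List.erase_append_left _ hjE]
      at this
  · intro k hk
    rw [hα, Function.update_of_ne fun he => hnd.1 (List.mem_map.2 ⟨k, hk, he⟩)]
    exact h.busy k (hperm.mem_iff.2 (List.mem_cons_of_mem _ hk))
  · intro t ht'
    rw [hα]
    by_cases he : t = (act j).tid
    · subst he
      rw [Function.update_self, hb.2]
    · rw [Function.update_of_ne he]
      refine h.idle t ?_
      rw [(hperm.map _).mem_iff, List.map_cons, List.mem_cons, not_or]
      exact ⟨he, ht'⟩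
  · intro t
    have hth := h.threads t
    rw [List.map_append, threadProj_append, List.map_singleton, hth]
    by_cases he : (act j).tid = t
    · subst he
      have hE : (E.map fun i => (act i).tid).Nodup := by
        have := h.nodup
        rw [List.map_append] at this
        exact this.of_append_left
      have hn := hnd.1
      rw [List.map_append, List.mem_append, not_or] at hn
      rw [threadProj_actTrace_of_mem hjE hE, threadProj_actTrace_eq_nil hn.1,
        threadProj_cons_of_eq (by rw [Act.tid_erase]; rfl)]
      simp [threadProj, Act.erase]
    · rw [threadProj_actTrace_erase_of_ne he,
        threadProj_cons_of_ne (by rw [Act.tid_erase]; exact he)]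
      simp [threadProj]

/-- The library can be run until the return that the client expects next has been reached. -/
theorem Simulates.advance (hfp : FootprintPreserving f) (hsl : StronglyLocal f)
    {i : ι} (hi : (act i).isCall = false)
    (h : Simulates f Γ σ₀ act ξ κ σc (i :: K₁) τ α β E D K₂ σα σl) :
    ∃ τ' α' β' E' D' K₂' σα' σl', foot σl' = foot σl ∧ i ∈ D' ∧
      Simulates f Γ σ₀ act ξ κ σc (i :: K₁) τ' α' β' E' D' K₂' σα' σl' := by
  induction β generalizing τ α E D K₂ σα σl with
  | nil =>
    -- With the library trace exhausted, all its actions are behind it; as `i` occurs in the library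
    -- history, it must be among the postponed returns.
    have hK₂ : K₂ = [] := List.map_eq_nil_iff.1 h.history_rest.symm
    have hmem : i ∈ D ++ K₂ := h.reorders.perm.mem_iff.1 (by simp)
    rw [hK₂, List.append_nil] at hmem
    exact ⟨_, _, _, _, _, _, _, _, rfl, hmem, h⟩
  | cons φ β ih =>
    by_cases hiD : i ∈ D
    · exact ⟨_, _, _, _, _, _, _, _, rfl, hiD, h⟩
    cases φ with
    | prim t c =>
      obtain ⟨_, _, hfoot, h⟩ := h.library_prim hfp hsl
      obtain ⟨_, _, _, _, _, _, _, _, hfoot', h'⟩ := ih h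
      exact ⟨_, _, _, _, _, _, _, _, hfoot'.trans hfoot, h'⟩
    | iface ψ =>
      have hist := h.history_rest
      rw [history_cons_iface, eq_comm, List.map_eq_cons_iff] at hist
      obtain ⟨j, K₂', rfl, rfl, -⟩ := hist
      cases hj : (act j).isCall with
      | false =>
        obtain ⟨_, h⟩ := h.library_ret hj
        exact ih h
      | true =>
        -- The client is waiting for `i`, so the order of returns and subsequent calls forces this
        -- call to have been made already.
        obtain ⟨_, h⟩ := h.library_call (h.reorders.mem_of_head hi hj hiD)
        exact ih h

end Simulation

/-! ### From linearizability to the replayed run -/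

section Abstraction

variable {S PComm Method : Type*}

theorem CallRetAct.isRet_iff {A : Type*} (ψ : CallRetAct A Method) :
    ψ.IsRet ↔ ψ.isCall = false := by
  cases ψ <;> simp [CallRetAct.IsRet, CallRetAct.isCall]

theorem CallRetAct.isCall_iff {A : Type*} (ψ : CallRetAct A Method) :
    ψ.IsCall ↔ ψ.isCall = true := by
  cases ψ <;> simp [CallRetAct.IsCall, CallRetAct.isCall]

/-- Actions are represented by their positions in the first history, so that repeated equal actions
remain distinct. `K` lists these positions in the order of the second history. -/
theorem HistLin.exists_reorders {H H' : List (CallRetAct S Method)} (h : HistLin H H') :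
    ∃ K : List (Fin H.length), Reorders H.get (List.finRange H.length) K ∧ H' = K.map H.get := by
  obtain ⟨ρ, hρ⟩ := h
  refine ⟨(List.finRange H'.length).map ρ.symm, ⟨?_, List.nodup_finRange _, ?_⟩, ?_⟩
  · refine (List.perm_ext_iff_of_nodup (List.nodup_finRange _)
      ((List.nodup_finRange _).map ρ.symm.injective)).2 fun i => ?_
    simp only [List.mem_finRange, List.mem_map, true_and, true_iff]
    exact ⟨ρ i, ρ.symm_apply_apply i⟩
  · intro i j hij hi hj
    have hlt : i < j := (List.pairwise_lt_finRange _).forall_sublist hij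
    have hρlt := (hρ i j).2 ⟨hlt, Or.inr ⟨(CallRetAct.isRet_iff _).2 hi,
      (CallRetAct.isCall_iff _).2 hj⟩⟩
    -- An increasing pair is a sublist of the increasing list of all positions; mapping back by
    -- `ρ.symm` puts `i` before `j` in `K`.
    have hsub : [ρ i, ρ j].Sublist (List.finRange H'.length) := by
      refine List.sublist_of_subperm_of_sortedLE ?_ ?_ ?_
      · exact List.subperm_of_subset (by simp [hρlt.ne]) fun x _ => List.mem_finRange x
      · exact List.Pairwise.sortedLE (by simp [hρlt.le])
      · exact ((List.pairwise_lt_finRange _).imp le_of_lt).sortedLE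
    simpa using hsub.map ρ.symm
  · rw [List.map_map]
    have : H.get ∘ ρ.symm = H'.get := by
      funext i
      simpa using (hρ (ρ.symm i) (ρ.symm i)).1
    rw [this, List.map_get_finRange]

variable [SepAlgebra S] {ι : Type*}

/-- By `threads`, a thread with an early call has performed its part of `α` followed by that call,
which the most general client allows since the thread is outside methods in `α`. Any other thread
has performed a prefix of its part of `α`. -/
theorem Simulates.part_true_mem {L : Library PComm Method} {f : Transformers S PComm}
    {Γ : Spec S Method} (hL : LibraryHasSpec L Γ) {σ₀ σc σα σl : S}
    {act : ι → CallRetAct S Method} {ξ κ α β : Trace S PComm Method}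
    {τ : Trace Unit PComm Method} {E D K₁ K₂ : List ι} (hξ : ξ.map Act.erase ∈ libraryTraces L)
    (h : Simulates f Γ σ₀ act ξ κ σc K₁ τ α β E D K₂ σα σl) :
    part true (fun _ => false) τ ∈ libraryTraces L := by
  have hLp := hL.primitiveBodies
  rw [mem_libraryTraces_iff hLp] at hξ ⊢
  intro t
  have hα : threadProj (α.map Act.erase) t ∈ prefixClosure (mgcTraces L t) := by
    refine prefixClosure_of_prefix (hξ t) ?_
    rw [← h.split, List.map_append, threadProj_append]
    exact List.prefix_append ..
  have hth := h.threads t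
  by_cases ht : t ∈ E.map fun i => (act i).tid
  · obtain ⟨i, hi, rfl⟩ := List.mem_map.1 ht
    have hnd := h.nodup
    rw [List.map_append] at hnd
    have hD : (act i).tid ∉ D.map fun i => (act i).tid := fun hD =>
      List.disjoint_of_nodup_append hnd ht hD
    rw [threadProj_actTrace_eq_nil hD, threadProj_actTrace_of_mem hi hnd.of_append_left,
      List.append_nil] at hth
    rw [hth]
    have hin := (h.busy i (List.mem_append_left _ hi)).1
    rw [← inside_map_erase, inside_apply] at hin
    obtain ⟨hc, hΓ⟩ := h.calls i hi
    cases hi' : act i with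
    | call t m a =>
      rw [hi'] at hin hΓ hα
      exact mgcTraces_call hLp ((hL.1 m).2 hΓ) (hL.bodyTraces_nonempty hΓ t) hα hin
    | ret t m a => simp [hi', CallRetAct.isCall] at hc
  · rw [threadProj_actTrace_eq_nil ht, List.append_nil] at hth
    exact prefixClosure_of_prefix hα (hth ▸ List.prefix_append ..)

variable [DecidableEq ι]

/-- Induction along the client's run, comparing footprints with the first library at each transfer.
A call adds the same piece to both libraries. Before a return the second library is advanced, which
preserves its footprint, and then the same piece is removed from both. A library step of the first
run needs no counterpart. -/
theorem JointRun.exists_simulates (hS : CancellativeOnFootprints S) {f : Transformers S PComm}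
    (hfp : FootprintPreserving f) (hsl : StronglyLocal f) {Γ : Spec S Method}
    {σc₀ σl₀ σ₀ τ₀ ω : S} {act : ι → CallRetAct S Method} {K K' : List ι}
    {ξ : Trace S PComm Method} (hbelow : FootBelow τ₀ σl₀) (h₀ : op σc₀ τ₀ = some σ₀)
    (hξ : Runs (evalLibrary f Γ) τ₀ ξ ω) (halt : Alternates (fun _ => false) ξ)
    (hist : history ξ = K'.map act) (hK : Reorders act K K')
    {κ : Trace S PComm Method} {σc σl : S} (hJ : JointRun f Γ σc₀ σl₀ κ σc σl) :
    ∀ K₀ K₁, K = K₀ ++ K₁ → history κ = K₀.map act → ∃ τ α β E D K₂ σα σr,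
      FootBelow σr σl ∧ Simulates f Γ σ₀ act ξ κ σc K₁ τ α β E D K₂ σα σr := by
  induction hJ with
  | init =>
    rintro K₀ K₁ hK₀ hh
    obtain rfl : K₀ = [] := List.map_eq_nil_iff.1 hh.symm
    refine ⟨[], [], ξ, [], [], K', τ₀, τ₀, hbelow, ?_⟩
    exact
      { run := ⟨σ₀, rfl, h₀⟩
        rest := ⟨ω, hξ⟩
        alternates := halt
        history_rest := hist
        split := rfl
        adds := rfl
        calls := by simp
        rets := by simp
        reorders := by simpa [← hK₀] using hK
        nodup := by simp
        busy := by simp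
        idle := by simp
        threads := fun t => rfl
        client := rfl }
  | client _ hin hp hσ ih =>
    intro K₀ K₁ hK₀ hh
    rw [history_append, history_cons_prim, history_nil, List.append_nil] at hh
    obtain ⟨_, _, _, _, _, _, _, _, hb, h⟩ := ih K₀ K₁ hK₀ hh
    exact ⟨_, _, _, _, _, _, _, _, hb, h.client_prim hfp hsl hin hp hσ⟩
  | library _ hfoot ih =>
    intro K₀ K₁ hK₀ hh
    obtain ⟨_, _, _, _, _, _, _, _, hb, h⟩ := ih K₀ K₁ hK₀ hh
    exact ⟨_, _, _, _, _, _, _, _, hb.congr_right hfoot.symm, h⟩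
  | call _ hin hΓ hc hl ih =>
    intro K₀ K₁ hK₀ hh
    rw [history_append, eq_comm, List.map_eq_append_iff] at hh
    obtain ⟨K₀, l, rfl, hh, hl'⟩ := hh
    obtain ⟨i, rfl, hi⟩ := List.map_eq_singleton_iff.1 hl'
    obtain ⟨_, _, _, _, _, _, _, σr, hb, h⟩ := ih K₀ (i :: K₁) (by simpa using hK₀) hh.symm
    obtain ⟨σr', hr⟩ := hb.compatible ⟨_, hl⟩
    rw [← hi]
    exact ⟨_, _, _, _, _, _, _, σr', hb.op_congr hr hl, h.call (by rw [hi]; rfl)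
      (by rw [hi]; simp [CallRetAct.method, hΓ]) (by rw [hi]; exact hin) (by rw [hi]; exact hc)
      (by rw [hi]; exact hr)⟩
  | ret _ hc hl ih =>
    intro K₀ K₁ hK₀ hh
    rw [history_append, eq_comm, List.map_eq_append_iff] at hh
    obtain ⟨K₀, l, rfl, hh, hl'⟩ := hh
    obtain ⟨i, rfl, hi⟩ := List.map_eq_singleton_iff.1 hl'
    obtain ⟨_, _, _, _, _, _, _, σr, hb, h⟩ := ih K₀ (i :: K₁) (by simpa using hK₀) hh.symm
    obtain ⟨_, _, _, _, _, _, _, _, hfoot, hiD, h⟩ := h.advance hfp hsl (by rw [hi]; rfl)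
    obtain ⟨σr', hr, h⟩ := h.ret hiD (by rw [hi]; exact hc)
    rw [hi] at hr
    rw [← hi]
    exact ⟨_, _, _, _, _, _, _, σr', (hb.congr_left hfoot.symm).cancel hS hr hl, h⟩

end Abstraction

end OwnershipTransfer

/-! ### Assembly of the abstraction theorem -/

theorem mainTheorem1 {S PComm Method : Type*} [SepAlgebra S]
    (hS : CancellativeOnFootprints S)
    (f : Transformers S PComm) (hfp : FootprintPreserving f) (hsl : StronglyLocal f)
    (Γ : Spec S Method) (hΓ : PreciseSpec Γ)
    (L₁ L₂ : Library PComm Method) (hL₁ : LibraryHasSpec L₁ Γ) (hL₂ : LibraryHasSpec L₂ Γ)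
    {n : ℕ} (C : Client PComm Method n) (hC : ClientHasSpec Γ C)
    (I I₁ I₂ : Set S)
    (hsafe₁ : Safe (librarySem f L₁ Γ) I₁)
    (hsafe₂ : Safe (librarySem f L₂ Γ) I₂)
    (hsafe : Safe (clientSem f Γ C) I)
    (hlin : LinearizedBy f Γ L₁ I₁ L₂ I₂) :
    (Safe (completeSem f C L₁) (setOp I I₁) ∧ Safe (completeSem f C L₂) (setOp I I₂)) ∧
    ∀ x₁ ∈ runs (completeSem f C L₁) (setOp I I₁),
      ∃ x₂ ∈ runs (completeSem f C L₂) (setOp I I₂), client x₁.2 = client x₂.2 := by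
  have hs₁ := safe_complete hfp hsl hL₁.primitiveBodies hsafe hsafe₁
  have hs₂ := safe_complete hfp hsl hL₂.primitiveBodies hsafe hsafe₂
  refine ⟨⟨hs₁, hs₂⟩, ?_⟩
  rintro ⟨σ₁, τ₁⟩ ⟨hσ₁, hτ₁⟩
  obtain ⟨hmem, σ', hrun⟩ := (mem_denote (onlyAnnotates_evalComplete f) (hs₁ σ₁ hσ₁)).1 hτ₁
  simp only [map_erase_unit] at hmem hrun
  obtain ⟨σc₀, hσc₀, σl₀, hσl₀, hop₁⟩ := hσ₁
  have hL₁p := hL₁.primitiveBodies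
  obtain ⟨κ, ξ₁, σc, σl, -, hJ, -, hξ₁, hκe, hξe, hh⟩ := decomposes_of_runs hfp hsl hL₁p
    ((denote_ne_fault_iff (onlyAnnotates_evalClient f Γ) prefixClosure_of_snoc).1 (hsafe σc₀ hσc₀))
    ((denote_ne_fault_iff (onlyAnnotates_evalLibrary f Γ) prefixClosure_of_snoc).1
      (hsafe₁ σl₀ hσl₀)) hop₁ τ₁ hmem hrun
  have hξ₁mem : ξ₁.map Act.erase ∈ libraryTraces L₁ :=
    hξe ▸ part_true_mem_libraryTraces hL₁p hmem
  obtain ⟨_, ⟨⟨σl₂, ξ₂⟩, ⟨hσl₂, hξ₂⟩, rfl⟩, hle, hhl⟩ := hlin (foot σl₀, history ξ₁)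
    ⟨(σl₀, ξ₁), ⟨hσl₀, (mem_denote (onlyAnnotates_evalLibrary f Γ) (hsafe₁ σl₀ hσl₀)).2
      ⟨hξ₁mem, σl, hξ₁⟩⟩, rfl⟩
  obtain ⟨hξ₂mem, ω, hξ₂run⟩ := (mem_denote (onlyAnnotates_evalLibrary f Γ)
    (hsafe₂ σl₂ hσl₂)).1 hξ₂
  have hbelow := hle.footBelow
  -- The client's initial state is compatible with that of the first library, hence with the
  -- second's, whose footprint is smaller.
  obtain ⟨σ₂, hop₂⟩ := hbelow.compatible ⟨σ₁, op_comm_of hop₁⟩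
  obtain ⟨K, hK, hK₂⟩ := hhl.exists_reorders
  have halt : Alternates (fun _ => false) ξ₂ := alternates_map_erase.1 <|
    alternates_of_threads fun t => mgcTraces_alternates hL₂.primitiveBodies
      ((mem_libraryTraces_iff hL₂.primitiveBodies).1 hξ₂mem t)
  -- Applied to the whole client run, with no calls or returns left to replay. The library trace
  -- need not be used up: what remains of it is discarded.
  obtain ⟨τ₂, _, _, _, _, _, _, _, -, h⟩ := hJ.exists_simulates hS hfp hsl hbelow
    (op_comm_of hop₂) hξ₂run halt hK₂ hK _ [] (List.append_nil _).symm
    (by rw [List.map_get_finRange, hh])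
  have hclient : part false (fun _ => false) τ₂ = part false (fun _ => false) τ₁ :=
    h.client.trans hκe
  -- The client part is inherited from `τ₁`, a trace of the program with the first library; the
  -- library part comes from the second library's own trace.
  have hτ₂ : τ₂ ∈ completeTraces L₂ C := mem_completeTraces_of_parts hL₂ hC
    (hclient ▸ part_false_mem_clientTraces hL₁p hmem) (h.part_true_mem hL₂ hξ₂mem)
  have hσ₂ : σ₂ ∈ setOp I I₂ := ⟨σc₀, hσc₀, σl₂, hσl₂, op_comm_of hop₂⟩
  obtain ⟨σ, hr, -⟩ := h.run
  refine ⟨(σ₂, τ₂), ⟨hσ₂, ?_⟩, ?_⟩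
  · exact (mem_denote (onlyAnnotates_evalComplete f) (hs₂ σ₂ hσ₂)).2
      ⟨by rwa [map_erase_unit], σ, hr⟩
  · rw [client_eq_part, client_eq_part, hclient]
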